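/- Identify $\mathbb{C}^n$ with $\mathbb{R}^{2n}$ through the real and imaginary parts $x_1,\dots,x_{2n}$ of the complex coordinates. For $1\le j\le 2n$ write $x=(x_j,X_j)$, where $X_j\in\mathbb{R}^{2n-1}$ collects the coordinates other than $x_j$, and for $A\subset\mathbb{C}^n$ put $A(X_j)=\{x_j\in\mathbb{R} : (x_j,X_j)\in A\}$. Let $\mathcal{H}^{\alpha}$ denote $\alpha$-dimensional Hausdorff measure. **Theorem.** Let $\Omega$ be a domain in $\mathbb{C}^n$, $n\ge 1$, let $E\subset\Omega$ be closed in $\Omega$, and suppose $\mathcal{H}^{2n-1}(E)<+\infty$ (so that $E$ has Lebesgue measure zero). Let $f=u+iv:\Omega\setminus E\to\mathbb{C}$ be holomorphic, with $u,v$ real valued, such that: (i) $f\in\mathcal{L}^1_{\mathrm{loc}}(\Omega)$. (ii) For each $j$, $1\le j\le 2n$, $\dfrac{\partial^2u}{\partial x_j^2}\in\mathcal{L}^1_{\mathrm{loc}}(\Omega)$ and $\dfrac{\partial^2v}{\partial x_j^2}\in\mathcal{L}^1_{\mathrm{loc}}(\Omega)$. (iii) For each $j$, $1\le j\le 2n$,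 and for $\mathcal{H}^{2n-1}$-almost all $X_j\in\mathbb{R}^{2n-1}$ such that $E(X_j)$ is finite, the following holds: for each $x_j^0\in E(X_j)$ there exist sequences $a_l,b_l\in(\Omega\setminus E)(X_j)$, $l=1,2,\dots$, such that $a_l\nearrow x_j^0$ and $b_l\searrow x_j^0$ as $l\to+\infty$, and (a) $\displaystyle\lim_{l\to+\infty}f(a_l,X_j)=\lim_{l\to+\infty}f(b_l,X_j)\in\mathbb{C}$ (both limits exist), (b) $\displaystyle-\infty<\liminf_{l\to+\infty}\frac{\partial u}{\partial x_j}(a_l,X_j)=\limsup_{l\to+\infty}\frac{\partial u}{\partial x_j}(b_l,X_j)<+\infty$ and $\displaystyle-\infty<\liminf_{l\to+\infty}\frac{\partial v}{\partial x_j}(a_l,X_j)=\limsup_{l\to+\infty}\frac{\partial v}{\partial x_j}(b_l,X_j)<+\infty$. Then $f$ has a unique holomorphic extension to $\Omega$. -/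

import Mathlib

open Filter Topology MeasureTheory

noncomputable section

namespace HolExt

/-- `ℂⁿ` with its Euclidean norm. -/
abbrev CSpace (n : ℕ) : Type := EuclideanSpace ℂ (Fin n)

/-- Labels of the `2n` real coordinates of `ℂⁿ`: `(k, 0)` is the real part and `(k, 1)` the
imaginary part of the `k`-th complex coordinate. -/
abbrev RealIdx (n : ℕ) : Type := Fin n × Fin 2

/-- The identification of `ℝ²ⁿ` with `ℂⁿ`. -/
def ofReal {n : ℕ} (x : EuclideanSpace ℝ (RealIdx n)) : CSpace n :=
  WithLp.toLp 2 fun k => (⟨x (k, 0), x (k, 1)⟩ : ℂ)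

/-- The space `ℝ²ⁿ⁻¹` of all the real coordinates except the `j`-th one. -/
abbrev Others {n : ℕ} (j : RealIdx n) : Type := EuclideanSpace ℝ {i : RealIdx n // i ≠ j}

/-- The point `(x_j, X_j)` of `ℂⁿ` whose `j`-th real coordinate is `t` and whose other real
coordinates are given by `X`. -/
def point {n : ℕ} (j : RealIdx n) (t : ℝ) (X : Others j) : CSpace n :=
  ofReal (WithLp.toLp 2 fun i => if h : i = j then t else X ⟨i, h⟩)

/-- The slice `A(X_j)` of a set `A ⊆ ℂⁿ` along the coordinate line through `X`. -/
def slice {n : ℕ} (j : RealIdx n) (A : Set (CSpace n)) (X : Others j) : Set ℝ :=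
  {t : ℝ | point j t X ∈ A}

/-- The partial derivative `∂g/∂x_j` with respect to the `j`-th real coordinate. -/
def partialDeriv {n : ℕ} (j : RealIdx n) (g : CSpace n → ℝ) (z : CSpace n) : ℝ :=
  lineDeriv ℝ g z (ofReal (EuclideanSpace.single j 1))

/-- `g ∈ L¹_loc(Ω)` for a function `g` that is given on `Ω \ E` only: the values of `g` on `E`
play no role. -/
def L1loc {n : ℕ} {F : Type*} [NormedAddCommGroup F] (g : CSpace n → F)
    (Ω E : Set (CSpace n)) : Prop :=
  LocallyIntegrableOn g Ω (volume.restrict (Ω \ E))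

/-- For the real valued function `g` and the sequences `a`, `b` in the `j`-th coordinate line
through `X`: the lower limit of `∂g/∂x_j` along `a` and the upper limit of `∂g/∂x_j` along `b`,
both taken in `[-∞, ∞]`, are equal and finite. -/
def MatchingSlopes {n : ℕ} (j : RealIdx n) (g : CSpace n → ℝ) (X : Others j) (a b : ℕ → ℝ) :
    Prop :=
  ∃ s : ℝ,
    liminf (fun l => (partialDeriv j g (point j (a l) X) : EReal)) atTop = (s : EReal) ∧
    limsup (fun l => (partialDeriv j g (point j (b l) X) : EReal)) atTop = (s : EReal)

end HolExt

end

/-!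
By Eilenberg's inequality almost every line parallel to a real coordinate axis meets `E` in a
finite set. On such a line (iii) says that `f` and its derivative do not jump, so that `f` is
absolutely continuous with derivative in the same class, and a one-dimensional interpolation
inequality bounds the integral of `‖∂f/∂x_j‖` by those of `‖f‖` and `‖∂²f/∂x_j²‖`. Integrating
over the lines shows that `∂f/∂x_j` is locally integrable and is the weak derivative of `f` across
`E`; hence the Cauchy-Riemann equations hold weakly on `Ω`. Finally a weakly holomorphic function
is holomorphic (Weyl's lemma): mollifiers which are invariant under rotations `w ↦ c w`, `|c| = 1`,
reproduce holomorphic functions, so by commutativity of convolution the mollifications of `f` do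
not depend on the mollifier.
-/

noncomputable section

namespace HolExt

/-! ### Functions of one variable without jumps -/

section OneVariable

variable {F : Type*} [NormedAddCommGroup F] {g : ℝ → F} {a b : ℝ}

/-- The one-sided limits of `g` at `x` agree whenever both of them exist. The value `g x` plays no
role, so this makes sense for functions that are only given off `x`. -/
def NoJumpAt (g : ℝ → F) (x : ℝ) : Prop :=
  ∀ l r, Tendsto g (𝓝[<] x) (𝓝 l) → Tendsto g (𝓝[>] x) (𝓝 r) → l = r

theorem noJumpAt_of_continuousAt {x : ℝ} (hg : ContinuousAt g x) : NoJumpAt g x :=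
  fun _ _ hl hr =>
    (tendsto_nhds_unique hl (hg.tendsto.mono_left nhdsWithin_le_nhds)).trans
      (tendsto_nhds_unique (hg.tendsto.mono_left nhdsWithin_le_nhds) hr)

theorem NoJumpAt.sub_continuousAt {P : ℝ → F} {x : ℝ} (hg : NoJumpAt g x)
    (hP : ContinuousAt P x) : NoJumpAt (fun t => g t - P t) x := by
  intro l r hl hr
  have hPl : Tendsto P (𝓝[<] x) (𝓝 (P x)) := hP.tendsto.mono_left nhdsWithin_le_nhds
  have hPr : Tendsto P (𝓝[>] x) (𝓝 (P x)) := hP.tendsto.mono_left nhdsWithin_le_nhds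
  refine add_right_cancel (hg (l + P x) (r + P x) ?_ ?_)
  · simpa only [sub_add_cancel] using hl.add hPl
  · simpa only [sub_add_cancel] using hr.add hPr

variable [NormedSpace ℝ F]

theorem exists_eqOn_const_of_hasDerivAt_zero_off_finite {D : ℝ → F} {S : Set ℝ} (hS : S.Finite)
    (hD : ∀ t ∈ Set.Ioo a b \ S, HasDerivAt D 0 t) (hjump : ∀ x ∈ Set.Ioo a b, NoJumpAt D x) :
    ∃ d, ∀ t ∈ Set.Ioo a b \ S, D t = d := by
  induction S, hS using Set.Finite.induction_on generalizing a b with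
  | empty =>
    simp only [Set.sdiff_empty] at hD ⊢
    exact isOpen_Ioo.exists_is_const_of_deriv_eq_zero isPreconnected_Ioo
      (fun t ht => (hD t ht).differentiableAt.differentiableWithinAt) (fun t ht => (hD t ht).deriv)
  | @insert x S hxS hS ih =>
    by_cases hx : x ∈ Set.Ioo a b
    swap
    · have hdiff : Set.Ioo a b \ insert x S = Set.Ioo a b \ S := by grind
      rw [hdiff] at hD ⊢
      exact ih hD hjump
    obtain ⟨l, hl⟩ := ih (a := a) (b := x) (fun t ht => hD t (by grind))
      (fun t ht => hjump t (by grind))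
    obtain ⟨r, hr⟩ := ih (a := x) (b := b) (fun t ht => hD t (by grind))
      (fun t ht => hjump t (by grind))
    have hSx : Sᶜ ∈ 𝓝 x := hS.isClosed.isOpen_compl.mem_nhds hxS
    have hleft : Tendsto D (𝓝[<] x) (𝓝 l) := tendsto_const_nhds.congr' <| by
      filter_upwards [Ioo_mem_nhdsLT hx.1, nhdsWithin_le_nhds hSx] with t ht htS
      exact (hl t ⟨ht, htS⟩).symm
    have hright : Tendsto D (𝓝[>] x) (𝓝 r) := tendsto_const_nhds.congr' <| by
      filter_upwards [Ioo_mem_nhdsGT hx.2, nhdsWithin_le_nhds hSx] with t ht htS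
      exact (hr t ⟨ht, htS⟩).symm
    obtain rfl : l = r := hjump x hx l r hleft hright
    refine ⟨l, fun t ht => ?_⟩
    rcases lt_trichotomy t x with htx | rfl | hxt
    · exact hl t (by grind)
    · exact absurd (Set.mem_insert t S) ht.2
    · exact hr t (by grind)

theorem contDiffAt_deriv {n : WithTop ℕ∞} {t : ℝ} (hg : ContDiffAt ℝ (n + 1) g t) :
    ContDiffAt ℝ n (deriv g) t :=
  (hg.fderiv_right le_rfl).clm_apply contDiffAt_const

/-- `g` is continuously differentiable on `U` up to finitely many points, none of which is a jump.
This is the regularity of the restriction of `f` to a generic coordinate line. -/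
structure JumpFreeC1On (g : ℝ → F) (U : Set ℝ) : Prop where
  finite_singular : {t ∈ U | ¬ContDiffAt ℝ 1 g t}.Finite
  noJumpAt : ∀ x ∈ U, NoJumpAt g x

theorem jumpFreeC1On_of_contDiffAt {U S : Set ℝ} (hS : S.Finite)
    (hg : ∀ t ∈ U \ S, ContDiffAt ℝ 1 g t) (hjump : ∀ x ∈ S, NoJumpAt g x) :
    JumpFreeC1On g U where
  finite_singular := hS.subset fun t ht => by_contra fun htS => ht.2 (hg t ⟨ht.1, htS⟩)
  noJumpAt x hx := by
    by_cases hxS : x ∈ S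
    · exact hjump x hxS
    · exact noJumpAt_of_continuousAt (hg x ⟨hx, hxS⟩).continuousAt

theorem JumpFreeC1On.mono {U V : Set ℝ} (hg : JumpFreeC1On g V) (hUV : U ⊆ V) :
    JumpFreeC1On g U where
  finite_singular := hg.finite_singular.subset fun _ ht => ⟨hUV ht.1, ht.2⟩
  noJumpAt x hx := hg.noJumpAt x (hUV hx)

theorem JumpFreeC1On.ae_contDiffAt (hg : JumpFreeC1On g (Set.Ioo a b)) :
    ∀ᵐ t ∂volume.restrict (Set.Ioc a b), t ∈ Set.Ioo a b ∧ ContDiffAt ℝ 1 g t := by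
  rw [ae_restrict_iff' measurableSet_Ioc]
  filter_upwards [hg.finite_singular.countable.ae_notMem volume,
    (Set.countable_singleton b).ae_notMem volume] with t hsing htb ht
  have htI : t ∈ Set.Ioo a b := ⟨ht.1, lt_of_le_of_ne ht.2 htb⟩
  exact ⟨htI, by_contra fun h => hsing ⟨htI, h⟩⟩

variable [CompleteSpace F]

theorem hasDerivAt_integral_deriv_of_contDiffAt {t : ℝ} (ht : t ∈ Set.Ioo a b)
    (hg : ContDiffAt ℝ 1 g t) (hi : IntervalIntegrable (deriv g) volume a b) :
    HasDerivAt (fun s => ∫ x in a..s, deriv g x) (deriv g t) t := by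
  have hsub : IntervalIntegrable (deriv g) volume a t := hi.mono_set <|
    Set.uIcc_subset_uIcc_left (Set.mem_uIcc_of_le ht.1.le ht.2.le)
  have hcont : ContinuousAt (deriv g) t :=
    (contDiffAt_deriv (n := 0) (by rwa [zero_add])).continuousAt
  exact intervalIntegral.integral_hasDerivAt_right hsub
    (stronglyMeasurable_deriv g).stronglyMeasurableAtFilter hcont

namespace JumpFreeC1On

theorem exists_eq_add_integral_deriv (hg : JumpFreeC1On g (Set.Ioo a b))
    (hi : IntervalIntegrable (deriv g) volume a b) :
    ∃ d, ∀ t ∈ Set.Ioo a b, ContDiffAt ℝ 1 g t → g t = d + ∫ x in a..t, deriv g x := by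
  set P : ℝ → F := fun t => ∫ x in a..t, deriv g x
  have hPcont : ∀ x ∈ Set.Ioo a b, ContinuousAt P x := fun x hx =>
    (intervalIntegral.continuousOn_primitive_interval' hi Set.left_mem_uIcc).continuousAt
      (by rw [Set.uIcc_of_le (hx.1.trans hx.2).le]; exact Icc_mem_nhds hx.1 hx.2)
  obtain ⟨d, hd⟩ := exists_eqOn_const_of_hasDerivAt_zero_off_finite (D := fun t => g t - P t)
    hg.finite_singular
    (fun t ht => by
      have hgt : ContDiffAt ℝ 1 g t := by_contra fun h => ht.2 ⟨ht.1, h⟩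
      have hD := (hgt.differentiableAt one_ne_zero).hasDerivAt.sub
        (hasDerivAt_integral_deriv_of_contDiffAt ht.1 hgt hi)
      rwa [sub_self] at hD)
    (fun x hx => (hg.noJumpAt x hx).sub_continuousAt (hPcont x hx))
  exact ⟨d, fun t ht hgt => sub_eq_iff_eq_add.1 (hd t ⟨ht, fun h => h.2 hgt⟩)⟩

theorem intervalIntegrable (hg : JumpFreeC1On g (Set.Ioo a b)) (hab : a ≤ b)
    (hi : IntervalIntegrable (deriv g) volume a b) : IntervalIntegrable g volume a b := by
  obtain ⟨d, hd⟩ := hg.exists_eq_add_integral_deriv hi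
  have hcont : ContinuousOn (fun t => d + ∫ x in a..t, deriv g x) (Set.uIcc a b) :=
    continuousOn_const.add (intervalIntegral.continuousOn_primitive_interval' hi Set.left_mem_uIcc)
  refine hcont.intervalIntegrable.congr_ae ?_
  rw [Set.uIoc_of_le hab]
  filter_upwards [hg.ae_contDiffAt] with t ht using (hd t ht.1 ht.2).symm

theorem integral_deriv_smul_eq_neg (hg : JumpFreeC1On g (Set.Ioo a b)) (hab : a ≤ b)
    (hi : IntervalIntegrable (deriv g) volume a b) {φ : ℝ → ℝ} (hφ : ContDiff ℝ 1 φ)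
    (ha : φ a = 0) (hb : φ b = 0) :
    ∫ t in a..b, deriv φ t • g t = -∫ t in a..b, φ t • deriv g t := by
  obtain ⟨d, hd⟩ := hg.exists_eq_add_integral_deriv hi
  set G : ℝ → F := fun t => d + ∫ x in a..t, deriv g x
  have hGcont : ContinuousOn G (Set.uIcc a b) :=
    continuousOn_const.add (intervalIntegral.continuousOn_primitive_interval' hi Set.left_mem_uIcc)
  have hgG : ∫ t in a..b, deriv φ t • g t = ∫ t in a..b, deriv φ t • G t := by
    refine intervalIntegral.integral_congr_ae_restrict ?_
    rw [Set.uIoc_of_le hab]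
    filter_upwards [hg.ae_contDiffAt] with t ht using congrArg (deriv φ t • ·) (hd t ht.1 ht.2)
  have hint : IntervalIntegrable (fun t => φ t • deriv g t) volume a b :=
    hi.continuousOn_smul hφ.continuous.continuousOn
  have hint' : IntervalIntegrable (fun t => deriv φ t • G t) volume a b :=
    ((hφ.continuous_deriv le_rfl).continuousOn.smul hGcont).intervalIntegrable
  have hprod := integral_eq_of_hasDerivAt_off_countable (fun t => φ t • G t)
    (fun t => φ t • deriv g t + deriv φ t • G t) hg.finite_singular.countable
    (hφ.continuous.continuousOn.smul hGcont)
    (fun t ht => by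
      rw [min_eq_left hab, max_eq_right hab] at ht
      have hgt : ContDiffAt ℝ 1 g t := by_contra fun h => ht.2 ⟨ht.1, h⟩
      exact (hφ.differentiable one_ne_zero t).hasDerivAt.smul
        ((hasDerivAt_integral_deriv_of_contDiffAt ht.1 hgt hi).const_add d))
    (hint.add hint')
  rw [intervalIntegral.integral_add hint hint', ha, hb, zero_smul, zero_smul, sub_zero] at hprod
  rw [hgG]
  exact eq_neg_of_add_eq_zero_right hprod

theorem norm_sub_le_integral_norm_deriv (hg : JumpFreeC1On g (Set.Ioo a b))
    (hi : IntervalIntegrable (deriv g) volume a b) {s t : ℝ} (hs : s ∈ Set.Ioo a b)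
    (ht : t ∈ Set.Ioo a b) (hgs : ContDiffAt ℝ 1 g s) (hgt : ContDiffAt ℝ 1 g t) :
    ‖g t - g s‖ ≤ ∫ x in a..b, ‖deriv g x‖ := by
  obtain ⟨d, hd⟩ := hg.exists_eq_add_integral_deriv hi
  have hab : a < b := hs.1.trans hs.2
  have hsub : ∀ y ∈ Set.Ioo a b, IntervalIntegrable (deriv g) volume a y := fun y hy =>
    hi.mono_set (Set.uIcc_subset_uIcc_left (Set.mem_uIcc_of_le hy.1.le hy.2.le))
  rw [hd t ht hgt, hd s hs hgs, add_sub_add_left_eq_sub,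
    intervalIntegral.integral_interval_sub_left (hsub t ht) (hsub s hs)]
  refine intervalIntegral.norm_integral_le_integral_norm_uIoc.trans ?_
  rw [intervalIntegral.integral_of_le hab.le]
  refine setIntegral_mono_set ?_ (ae_of_all _ fun _ => norm_nonneg _) ?_
  · exact ((intervalIntegrable_iff_integrableOn_Ioc_of_le hab.le).1 hi).norm
  · exact (Set.Ioc_subset_Ioc (le_min hs.1.le ht.1.le) (max_le hs.2.le ht.2.le)).eventuallyLE

theorem norm_integral_smul_sub_le (hg : JumpFreeC1On g (Set.Ioo a b))
    (hi : IntervalIntegrable (deriv g) volume a b) {ψ : ℝ → ℝ} (hψ : Continuous ψ)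
    (hψ0 : ∀ x ∈ Set.Ioo a b, 0 ≤ ψ x) {t : ℝ} (ht : t ∈ Set.Ioo a b)
    (hgt : ContDiffAt ℝ 1 g t) :
    ‖∫ x in a..b, ψ x • (g t - g x)‖ ≤ (∫ x in a..b, ψ x) * ∫ x in a..b, ‖deriv g x‖ := by
  have hab : a < b := ht.1.trans ht.2
  rw [← intervalIntegral.integral_mul_const, intervalIntegral.integral_of_le hab.le,
    intervalIntegral.integral_of_le hab.le]
  refine norm_integral_le_of_norm_le (Continuous.integrableOn_Ioc (by fun_prop)) ?_
  filter_upwards [hg.ae_contDiffAt] with x hx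
  rw [norm_smul, Real.norm_of_nonneg (hψ0 x hx.1)]
  exact mul_le_mul_of_nonneg_left
    (hg.norm_sub_le_integral_norm_deriv hi hx.1 ht hx.2 hgt) (hψ0 x hx.1)

theorem norm_integral_smul_deriv_le (hg : JumpFreeC1On g (Set.Ioo a b)) (hab : a ≤ b)
    (hi : IntervalIntegrable (deriv g) volume a b) {φ : ℝ → ℝ} (hφ : ContDiff ℝ 1 φ)
    (ha : φ a = 0) (hb : φ b = 0) {C : ℝ} (hC : ∀ x ∈ Set.Ioc a b, |deriv φ x| ≤ C) :
    ‖∫ x in a..b, φ x • deriv g x‖ ≤ C * ∫ x in a..b, ‖g x‖ := by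
  rw [← norm_neg, ← hg.integral_deriv_smul_eq_neg hab hi hφ ha hb,
    ← intervalIntegral.integral_const_mul, intervalIntegral.integral_of_le hab,
    intervalIntegral.integral_of_le hab]
  refine norm_integral_le_of_norm_le ((hg.intervalIntegrable hab hi).norm.const_mul _).1 ?_
  refine (ae_restrict_iff' measurableSet_Ioc).2 (ae_of_all _ fun x hx => ?_)
  rw [norm_smul]
  exact mul_le_mul_of_nonneg_right (hC x hx) (norm_nonneg _)

end JumpFreeC1On

theorem integral_sub_mul_sub (a b : ℝ) :
    ∫ x in a..b, (x - a) * (b - x) = (b - a) ^ 3 / 6 := by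
  have h : ∀ x : ℝ, HasDerivAt (fun x : ℝ => (b - a) * (x - a) ^ 2 / 2 - (x - a) ^ 3 / 3)
      ((x - a) * (b - x)) x := fun x => by
    have hx : HasDerivAt (fun x : ℝ => x - a) 1 x := (hasDerivAt_id x).sub_const a
    refine ((((hx.pow 2).const_mul (b - a)).div_const 2).sub
      ((hx.pow 3).div_const 3)).congr_deriv ?_
    push_cast
    ring
  rw [intervalIntegral.integral_eq_sub_of_hasDerivAt (fun x _ => h x)
    (by apply Continuous.intervalIntegrable; fun_prop)]
  ring

namespace JumpFreeC1On

-- Test `deriv g` against the weight `ψ x = (x - a) * (b - x)`: since `ψ` vanishes at the endpoints,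
-- `(∫ ψ) • g' t = ∫ ψ • (g' t - g') - ∫ ψ' • g`.
theorem norm_deriv_le (hg : JumpFreeC1On g (Set.Ioo a b))
    (hg' : JumpFreeC1On (deriv g) (Set.Ioo a b))
    (hi : IntervalIntegrable (deriv (deriv g)) volume a b) {t : ℝ} (ht : t ∈ Set.Ioo a b)
    (hgt : ContDiffAt ℝ 1 (deriv g) t) :
    ‖deriv g t‖ ≤
      (∫ x in a..b, ‖deriv (deriv g) x‖) + 6 / (b - a) ^ 2 * ∫ x in a..b, ‖g x‖ := by
  have hab : a < b := ht.1.trans ht.2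
  have hL : 0 < b - a := sub_pos.2 hab
  have hi' : IntervalIntegrable (deriv g) volume a b := hg'.intervalIntegrable hab.le hi
  set ψ : ℝ → ℝ := fun x => (x - a) * (b - x)
  have hψ : ContDiff ℝ 1 ψ := by fun_prop
  have hψ' : ∀ x, deriv ψ x = (b - x) - (x - a) := fun x => by
    have := ((hasDerivAt_id x).sub_const a).mul ((hasDerivAt_id x).const_sub b)
    exact this.deriv.trans (by simp only [id]; ring)
  have hosc : ‖∫ x in a..b, ψ x • (deriv g t - deriv g x)‖ ≤
      (b - a) ^ 3 / 6 * ∫ x in a..b, ‖deriv (deriv g) x‖ :=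
    (hg'.norm_integral_smul_sub_le hi hψ.continuous
      (fun x hx => mul_nonneg (sub_nonneg.2 hx.1.le) (sub_nonneg.2 hx.2.le)) ht hgt).trans_eq
      (by rw [integral_sub_mul_sub])
  have hparts : ‖∫ x in a..b, ψ x • deriv g x‖ ≤ (b - a) * ∫ x in a..b, ‖g x‖ :=
    hg.norm_integral_smul_deriv_le hab.le hi' hψ (by simp [ψ]) (by simp [ψ]) fun x hx => by
      rw [hψ']
      exact abs_le.2 ⟨by linarith [hx.1, hx.2], by linarith [hx.1, hx.2]⟩
  have hsplit : ((b - a) ^ 3 / 6) • deriv g t =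
      (∫ x in a..b, ψ x • (deriv g t - deriv g x)) + ∫ x in a..b, ψ x • deriv g x := by
    have hψi : IntervalIntegrable (fun x => ψ x • deriv g x) volume a b :=
      hi'.continuousOn_smul hψ.continuous.continuousOn
    have hψt : IntervalIntegrable (fun x => ψ x • deriv g t) volume a b :=
      (hψ.continuous.smul continuous_const).intervalIntegrable a b
    simp only [smul_sub]
    rw [intervalIntegral.integral_sub hψt hψi, sub_add_cancel, intervalIntegral.integral_smul_const,
      integral_sub_mul_sub]
  have hnorm : (b - a) ^ 3 / 6 * ‖deriv g t‖ ≤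
      (b - a) ^ 3 / 6 * (∫ x in a..b, ‖deriv (deriv g) x‖) + (b - a) * ∫ x in a..b, ‖g x‖ := by
    rw [← Real.norm_of_nonneg (by positivity : 0 ≤ (b - a) ^ 3 / 6), ← norm_smul, hsplit,
      Real.norm_of_nonneg (by positivity : 0 ≤ (b - a) ^ 3 / 6)]
    exact (norm_add_le _ _).trans (add_le_add hosc hparts)
  refine le_of_mul_le_mul_left (hnorm.trans_eq ?_) (by positivity : 0 < (b - a) ^ 3 / 6)
  field_simp

theorem integral_norm_deriv_le (hg : JumpFreeC1On g (Set.Ioo a b))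
    (hg' : JumpFreeC1On (deriv g) (Set.Ioo a b)) (hab : a < b)
    (hi : IntervalIntegrable (deriv (deriv g)) volume a b) :
    ∫ t in a..b, ‖deriv g t‖ ≤
      (b - a) * (∫ t in a..b, ‖deriv (deriv g) t‖) + 6 / (b - a) * ∫ t in a..b, ‖g t‖ := by
  set C := (∫ x in a..b, ‖deriv (deriv g) x‖) + 6 / (b - a) ^ 2 * ∫ x in a..b, ‖g x‖ with hC
  have hle : ∫ t in a..b, ‖deriv g t‖ ≤ ∫ _ in a..b, C := by
    rw [intervalIntegral.integral_of_le hab.le, intervalIntegral.integral_of_le hab.le]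
    refine integral_mono_ae (hg'.intervalIntegrable hab.le hi).norm.1 (by simp) ?_
    filter_upwards [hg'.ae_contDiffAt] with t ht using hg.norm_deriv_le hg' hi ht.1 ht.2
  refine hle.trans_eq ?_
  have hL : b - a ≠ 0 := (sub_pos.2 hab).ne'
  rw [intervalIntegral.integral_const, smul_eq_mul, hC]
  field_simp

end JumpFreeC1On

end OneVariable

section Fubini

variable {F : Type*} [NormedAddCommGroup F] [NormedSpace ℝ F] [CompleteSpace F]
  {Y : Type*} [MeasurableSpace Y] {ν : Measure Y} [SFinite ν] {a b : ℝ} {h : Y × ℝ → F}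

theorem integrable_deriv_snd (hab : a < b)
    (hlines : ∀ᵐ y ∂ν, JumpFreeC1On (fun t => h (y, t)) (Set.Ioo a b) ∧
      JumpFreeC1On (deriv fun t => h (y, t)) (Set.Ioo a b))
    (hh : Integrable h (ν.prod (volume.restrict (Set.Ioc a b))))
    (hh' : AEStronglyMeasurable (fun p : Y × ℝ => deriv (fun t => h (p.1, t)) p.2)
      (ν.prod (volume.restrict (Set.Ioc a b))))
    (hh'' : Integrable (fun p : Y × ℝ => deriv (deriv fun t => h (p.1, t)) p.2)
      (ν.prod (volume.restrict (Set.Ioc a b)))) :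
    Integrable (fun p : Y × ℝ => deriv (fun t => h (p.1, t)) p.2)
      (ν.prod (volume.restrict (Set.Ioc a b))) := by
  refine (integrable_prod_iff hh').2 ⟨?_, ?_⟩
  · filter_upwards [hlines, hh''.prod_right_ae] with y hy hy''
    exact (hy.2.intervalIntegrable hab.le
      ((intervalIntegrable_iff_integrableOn_Ioc_of_le hab.le).2 hy'')).1
  · refine Integrable.mono' ((hh''.integral_norm_prod_left.const_mul (b - a)).add
      (hh.integral_norm_prod_left.const_mul (6 / (b - a)))) hh'.norm.integral_prod_right' ?_
    filter_upwards [hlines, hh''.prod_right_ae] with y hy hy''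
    have hline := hy.1.integral_norm_deriv_le hy.2 hab
      ((intervalIntegrable_iff_integrableOn_Ioc_of_le hab.le).2 hy'')
    simp only [intervalIntegral.integral_of_le hab.le] at hline
    rwa [Real.norm_of_nonneg (integral_nonneg fun _ => norm_nonneg _)]

theorem integral_deriv_snd_smul_eq_neg (hab : a ≤ b)
    (hlines : ∀ᵐ y ∂ν, JumpFreeC1On (fun t => h (y, t)) (Set.Ioo a b))
    (hh' : Integrable (fun p : Y × ℝ => deriv (fun t => h (p.1, t)) p.2)
      (ν.prod (volume.restrict (Set.Ioc a b))))
    {φ : Y × ℝ → ℝ} (hφ : ∀ y, ContDiff ℝ 1 fun t => φ (y, t))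
    (ha : ∀ y, φ (y, a) = 0) (hb : ∀ y, φ (y, b) = 0)
    (hφh : Integrable (fun p : Y × ℝ => deriv (fun t => φ (p.1, t)) p.2 • h p)
      (ν.prod (volume.restrict (Set.Ioc a b))))
    (hφh' : Integrable (fun p : Y × ℝ => φ p • deriv (fun t => h (p.1, t)) p.2)
      (ν.prod (volume.restrict (Set.Ioc a b)))) :
    ∫ p, deriv (fun t => φ (p.1, t)) p.2 • h p ∂ν.prod (volume.restrict (Set.Ioc a b)) =
      -∫ p, φ p • deriv (fun t => h (p.1, t)) p.2 ∂ν.prod (volume.restrict (Set.Ioc a b)) := by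
  rw [integral_prod _ hφh, integral_prod _ hφh', ← integral_neg]
  refine integral_congr_ae ?_
  filter_upwards [hlines, hh'.prod_right_ae] with y hy hy'
  simp only [← intervalIntegral.integral_of_le hab]
  exact hy.integral_deriv_smul_eq_neg hab
    ((intervalIntegrable_iff_integrableOn_Ioc_of_le hab).2 hy') (hφ y) (ha y) (hb y)

end Fubini

/-! ### Weak directional derivatives -/

section DirectionalDerivative

variable {V : Type*} [NormedAddCommGroup V] [NormedSpace ℝ V]
  {F : Type*} [NormedAddCommGroup F] [NormedSpace ℝ F]

/-- The derivative of `f` in the direction `e`, as a function of the point. -/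
def dirDeriv (e : V) (f : V → F) (z : V) : F := lineDeriv ℝ f z e

theorem deriv_comp_add_smul (e : V) (f : V → F) (z : V) (s : ℝ) :
    deriv (fun t : ℝ => f (z + t • e)) s = dirDeriv e f (z + s • e) := by
  have h := deriv_comp_const_add (fun t : ℝ => f (z + t • e)) s 0
  simp only [add_smul, ← add_assoc, add_zero] at h
  exact h.symm

/-- `f'` is the derivative of `f` on `U` in the direction `e`, in the sense of distributions. -/
def HasWeakDirDerivOn [MeasurableSpace V] (e : V) (f f' : V → F) (U : Set V) (μ : Measure V) :
    Prop :=
  ∀ φ : V → ℝ, ContDiff ℝ 1 φ → HasCompactSupport φ → tsupport φ ⊆ U →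
    ∫ z, fderiv ℝ φ z e • f z ∂μ = -∫ z, φ z • f' z ∂μ

theorem HasWeakDirDerivOn.mono [MeasurableSpace V] {e : V} {f f' : V → F} {U W : Set V}
    {μ : Measure V} (h : HasWeakDirDerivOn e f f' W μ) (hUW : U ⊆ W) :
    HasWeakDirDerivOn e f f' U μ :=
  fun φ hφ hcs hsupp => h φ hφ hcs (hsupp.trans hUW)

variable {Y : Type*} [NormedAddCommGroup Y] [NormedSpace ℝ Y] (Φ : (Y × ℝ) ≃L[ℝ] V)

theorem apply_prodMk_eq_add_smul (y : Y) (t : ℝ) : Φ (y, t) = Φ (y, 0) + t • Φ (0, 1) := by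
  rw [← map_smul, ← map_add, Prod.smul_mk, Prod.mk_add_mk, smul_zero, add_zero, smul_eq_mul,
    mul_one, zero_add]

theorem deriv_comp_prodMk (f : V → F) (y : Y) :
    deriv (fun t => f (Φ (y, t))) = fun t => dirDeriv (Φ (0, 1)) f (Φ (y, t)) := by
  have hline : (fun t => f (Φ (y, t))) = fun t => f (Φ (y, 0) + t • Φ (0, 1)) :=
    funext fun t => by rw [apply_prodMk_eq_add_smul]
  funext t
  rw [hline, deriv_comp_add_smul, ← apply_prodMk_eq_add_smul]

theorem dirDeriv_eq_fderiv {f : V → F} (e : V) {z : V} (hf : DifferentiableAt ℝ f z) :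
    dirDeriv e f z = fderiv ℝ f z e :=
  hf.lineDeriv_eq_fderiv

end DirectionalDerivative

theorem integrable_comp_smul_of_hasCompactSupport {V F X : Type*} [TopologicalSpace V]
    [NormedAddCommGroup F] [NormedSpace ℝ F] [TopologicalSpace X] [MeasurableSpace X]
    [OpensMeasurableSpace X] {κ : Measure X} {χ : V → ℝ} (hχ : Continuous χ)
    (hcs : HasCompactSupport χ) {ψ : X → V} (hψ : Continuous ψ) {k : X → F}
    (hk : Integrable k κ) : Integrable (fun x => χ (ψ x) • k x) κ := by
  obtain ⟨C, hC⟩ := hcs.exists_bound_of_continuous hχ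
  exact hk.bdd_smul C (hχ.comp hψ).aestronglyMeasurable (ae_of_all _ fun x => hC (ψ x))

section Box

variable {V : Type*} [NormedAddCommGroup V] [NormedSpace ℝ V] [MeasurableSpace V] [BorelSpace V]
  {F : Type*} [NormedAddCommGroup F]
  {Y : Type*} [NormedAddCommGroup Y] [NormedSpace ℝ Y] [MeasurableSpace Y] [BorelSpace Y]
  {Φ : (Y × ℝ) ≃L[ℝ] V} {μ : Measure V} {ν : Measure Y} [SFinite ν]
  {Ω : Set V} {B : Set Y} {a b : ℝ}

theorem aestronglyMeasurable_comp_box {k : V → F}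
    (hΦ : MeasurePreserving Φ (ν.prod volume) μ) (hbox : B ×ˢ Set.Icc a b ⊆ Φ ⁻¹' Ω)
    (hk : AEStronglyMeasurable k (μ.restrict Ω)) :
    AEStronglyMeasurable (k ∘ Φ) ((ν.restrict B).prod (volume.restrict (Set.Ioc a b))) := by
  have hΦΩ := hΦ.restrict_preimage_emb Φ.toHomeomorph.measurableEmbedding Ω
  rw [Measure.prod_restrict]
  exact (hk.comp_measurePreserving hΦΩ).mono_measure
    (Measure.restrict_mono ((Set.prod_mono_right Set.Ioc_subset_Icc_self).trans hbox) le_rfl)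

theorem integrable_comp_box {k : V → F}
    (hΦ : MeasurePreserving Φ (ν.prod volume) μ) (hB : IsCompact B)
    (hbox : B ×ˢ Set.Icc a b ⊆ Φ ⁻¹' Ω) (hk : LocallyIntegrableOn k Ω μ) :
    Integrable (k ∘ Φ) ((ν.restrict B).prod (volume.restrict (Set.Ioc a b))) := by
  have hemb : MeasurableEmbedding Φ := Φ.toHomeomorph.measurableEmbedding
  have hint : IntegrableOn k (Φ '' (B ×ˢ Set.Icc a b)) μ :=
    hk.integrableOn_compact_subset (Set.image_subset_iff.2 hbox)
      ((hB.prod isCompact_Icc).image Φ.continuous)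
  have hcomp := (hΦ.integrableOn_comp_preimage hemb).2 hint
  rw [Set.preimage_image_eq _ Φ.injective] at hcomp
  rw [Measure.prod_restrict]
  exact hcomp.mono_set (Set.prod_mono_right Set.Ioc_subset_Icc_self)

variable [NormedSpace ℝ F]

theorem integral_smul_eq_integral_box {k : V → F} {χ : V → ℝ}
    (hΦ : MeasurePreserving Φ (ν.prod volume) μ)
    (hχ : Function.support χ ⊆ Φ '' (B ×ˢ Set.Ioo a b)) :
    ∫ z, χ z • k z ∂μ =
      ∫ p, χ (Φ p) • k (Φ p) ∂(ν.restrict B).prod (volume.restrict (Set.Ioc a b)) := by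
  rw [Measure.prod_restrict, setIntegral_eq_integral_of_forall_compl_eq_zero,
    hΦ.integral_comp Φ.toHomeomorph.measurableEmbedding fun z => χ z • k z]
  intro p hp
  have hp' : Φ p ∉ Function.support χ := fun h => by
    obtain ⟨q, hq, hqp⟩ := hχ h
    exact hp (Φ.injective hqp ▸ ⟨hq.1, Set.Ioo_subset_Ioc_self hq.2⟩)
  rw [Function.notMem_support.1 hp', zero_smul]

variable [CompleteSpace F] {f : V → F}

theorem hasWeakDirDerivOn_box (hΦ : MeasurePreserving Φ (ν.prod volume) μ) (hB : IsCompact B)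
    (hab : a < b) (hbox : B ×ˢ Set.Icc a b ⊆ Φ ⁻¹' Ω)
    (hf : LocallyIntegrableOn f Ω μ)
    (hf' : AEStronglyMeasurable (dirDeriv (Φ (0, 1)) f) (μ.restrict Ω))
    (hf'' : LocallyIntegrableOn (dirDeriv (Φ (0, 1)) (dirDeriv (Φ (0, 1)) f)) Ω μ)
    (hlines : ∀ᵐ y ∂ν, JumpFreeC1On (fun t => f (Φ (y, t))) {t | Φ (y, t) ∈ Ω} ∧
      JumpFreeC1On (deriv fun t => f (Φ (y, t))) {t | Φ (y, t) ∈ Ω}) :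
    HasWeakDirDerivOn (Φ (0, 1)) f (dirDeriv (Φ (0, 1)) f) (Φ '' (B ×ˢ Set.Ioo a b)) μ := by
  intro φ hφ hcs hsupp
  have hlinesB : ∀ᵐ y ∂ν.restrict B, JumpFreeC1On (fun t => f (Φ (y, t))) (Set.Ioo a b) ∧
      JumpFreeC1On (deriv fun t => f (Φ (y, t))) (Set.Ioo a b) := by
    filter_upwards [ae_restrict_of_ae hlines, ae_restrict_mem hB.measurableSet] with y hy hyB
    have hsub : Set.Ioo a b ⊆ {t | Φ (y, t) ∈ Ω} := fun t ht =>
      hbox ⟨hyB, Set.Ioo_subset_Icc_self ht⟩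
    exact ⟨hy.1.mono hsub, hy.2.mono hsub⟩
  have hi : Integrable (dirDeriv (Φ (0, 1)) f ∘ Φ)
      ((ν.restrict B).prod (volume.restrict (Set.Ioc a b))) := by
    have h := integrable_deriv_snd (h := f ∘ Φ) hab hlinesB (integrable_comp_box hΦ hB hbox hf)
    simp only [Function.comp_apply, deriv_comp_prodMk] at h
    exact h (aestronglyMeasurable_comp_box hΦ hbox hf') (integrable_comp_box hΦ hB hbox hf'')
  have hsupp' : Function.support (fun z => fderiv ℝ φ z (Φ (0, 1))) ⊆
      Φ '' (B ×ˢ Set.Ioo a b) := fun z hz =>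
    hsupp (support_fderiv_subset ℝ fun h => hz (by simp only [h, zero_apply]))
  have hφ' : ∀ y : Y, deriv (fun t => φ (Φ (y, t))) = fun t => fderiv ℝ φ (Φ (y, t)) (Φ (0, 1)) :=
    fun y => (deriv_comp_prodMk Φ φ y).trans
      (funext fun t => dirDeriv_eq_fderiv _ (hφ.differentiable one_ne_zero _))
  have hvanish : ∀ t, t ∉ Set.Ioo a b → ∀ y, φ (Φ (y, t)) = 0 := fun t ht y => by
    by_contra h
    obtain ⟨q, hq, hqp⟩ := hsupp (subset_tsupport φ h)
    exact ht (by simpa only [Φ.injective hqp] using hq.2)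
  have hparts := integral_deriv_snd_smul_eq_neg (h := f ∘ Φ) (φ := φ ∘ Φ) hab.le
    (hlinesB.mono fun y hy => hy.1)
  simp only [Function.comp_apply, deriv_comp_prodMk Φ f, hφ'] at hparts
  rw [integral_smul_eq_integral_box hΦ hsupp',
    integral_smul_eq_integral_box hΦ ((subset_tsupport φ).trans hsupp)]
  exact hparts hi (fun y => hφ.comp (Φ.contDiff.comp (by fun_prop)))
    (hvanish a (by simp)) (hvanish b (by simp))
    (integrable_comp_smul_of_hasCompactSupport
      ((hφ.continuous_fderiv one_ne_zero).clm_apply continuous_const) (hcs.fderiv_apply ℝ _)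
      Φ.continuous (integrable_comp_box hΦ hB hbox hf))
    (integrable_comp_smul_of_hasCompactSupport hφ.continuous hcs Φ.continuous hi)

theorem eventually_hasWeakDirDerivOn [LocallyCompactSpace Y]
    (hΦ : MeasurePreserving Φ (ν.prod volume) μ) (hΩ : IsOpen Ω)
    (hf : LocallyIntegrableOn f Ω μ)
    (hf' : AEStronglyMeasurable (dirDeriv (Φ (0, 1)) f) (μ.restrict Ω))
    (hf'' : LocallyIntegrableOn (dirDeriv (Φ (0, 1)) (dirDeriv (Φ (0, 1)) f)) Ω μ)
    (hlines : ∀ᵐ y ∂ν, JumpFreeC1On (fun t => f (Φ (y, t))) {t | Φ (y, t) ∈ Ω} ∧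
      JumpFreeC1On (deriv fun t => f (Φ (y, t))) {t | Φ (y, t) ∈ Ω}) {z : V} (hz : z ∈ Ω) :
    ∀ᶠ U in (𝓝 z).smallSets, HasWeakDirDerivOn (Φ (0, 1)) f (dirDeriv (Φ (0, 1)) f) U μ := by
  obtain ⟨⟨y₀, t₀⟩, rfl⟩ := Φ.surjective z
  obtain ⟨B₀, hB₀, J, hJ, hBJ⟩ := mem_nhds_prod_iff.1
    ((hΩ.preimage Φ.continuous).mem_nhds hz)
  obtain ⟨B, hB, hBB₀, hBc⟩ := local_compact_nhds hB₀
  obtain ⟨a, b, ⟨ha, hb⟩, hab⟩ := mem_nhds_iff_exists_Ioo_subset.1 hJ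
  obtain ⟨a', haa', ha'⟩ := exists_between ha
  obtain ⟨b', hb', hbb'⟩ := exists_between hb
  have hbox : B ×ˢ Set.Icc a' b' ⊆ Φ ⁻¹' Ω :=
    (Set.prod_mono hBB₀ ((Set.Icc_subset_Ioo haa' hbb').trans hab)).trans hBJ
  have himage : Φ '' (B ×ˢ Set.Ioo a' b') ∈ 𝓝 (Φ (y₀, t₀)) :=
    Φ.toHomeomorph.isOpenMap.image_mem_nhds (prod_mem_nhds hB (Ioo_mem_nhds ha' hb'))
  filter_upwards [eventually_smallSets_subset.2 himage] with U hU
  exact (hasWeakDirDerivOn_box hΦ hBc (ha'.trans hb') hbox hf hf' hf'' hlines).mono hU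

end Box

section HolomorphicLines

variable {V : Type*} [NormedAddCommGroup V] [NormedSpace ℂ V] [NormedSpace ℝ V]
  [IsScalarTower ℝ ℂ V] {F : Type*} [NormedAddCommGroup F] [NormedSpace ℂ F]
  {W : Set V} {f : V → F}

theorem hasLineDerivAt_of_complex_differentiableAt (e : V) {z : V} (hf : DifferentiableAt ℂ f z) :
    HasLineDerivAt ℝ f (fderiv ℂ f z e) z e :=
  (hf.hasFDerivAt.restrictScalars ℝ).hasLineDerivAt e

theorem dirDeriv_eq_complex_fderiv (e : V) {z : V} (hf : DifferentiableAt ℂ f z) :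
    dirDeriv e f z = fderiv ℂ f z e :=
  (hasLineDerivAt_of_complex_differentiableAt e hf).lineDeriv

theorem dirDeriv_I_smul (e : V) {z : V} (hf : DifferentiableAt ℂ f z) :
    dirDeriv (Complex.I • e) f z = Complex.I • dirDeriv e f z := by
  rw [dirDeriv_eq_complex_fderiv _ hf, dirDeriv_eq_complex_fderiv _ hf, map_smul]

theorem contDiffAt_comp_add_smul [CompleteSpace F] (hW : IsOpen W) (hf : DifferentiableOn ℂ f W)
    (e : V) {z : V} {s : ℝ} (hs : z + s • e ∈ W) {n : WithTop ℕ∞} :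
    ContDiffAt ℝ n (fun t : ℝ => f (z + t • e)) s := by
  have hline : Differentiable ℂ fun ζ : ℂ => z + ζ • e := by fun_prop
  have hreal : ∀ t : ℝ, z + (t : ℂ) • e = z + t • e := fun t =>
    congrArg (z + ·) (algebraMap_smul ℂ t e)
  have hdiff : DifferentiableOn ℂ (fun ζ : ℂ => f (z + ζ • e)) ((fun ζ : ℂ => z + ζ • e) ⁻¹' W) :=
    hf.comp hline.differentiableOn (Set.mapsTo_preimage _ _)
  have hcont : ContDiffAt ℂ n (fun ζ : ℂ => f (z + ζ • e)) s :=
    (hdiff.analyticAt ((hW.preimage hline.continuous).mem_nhds (by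
      rwa [Set.mem_preimage, hreal]))).contDiffAt
  have hcomp : ContDiffAt ℝ n ((fun ζ : ℂ => f (z + ζ • e)) ∘ ((↑) : ℝ → ℂ)) s :=
    (hcont.restrict_scalars ℝ).comp s Complex.ofRealCLM.contDiff.contDiffAt
  simpa only [Function.comp_def, hreal] using hcomp

end HolomorphicLines

theorem aestronglyMeasurable_dirDeriv {V : Type*} [NormedAddCommGroup V] [NormedSpace ℝ V]
    [MeasurableSpace V] [BorelSpace V] [SecondCountableTopology V] {μ : Measure V}
    {F : Type*} [NormedAddCommGroup F] [NormedSpace ℝ F] {e : V} {W : Set V} {f : V → F}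
    (hW : IsOpen W) (hf : ContinuousOn f W) (hd : ∀ z ∈ W, LineDifferentiableAt ℝ f z e) :
    AEStronglyMeasurable (dirDeriv e f) (μ.restrict W) := by
  have hfm : StronglyMeasurable (W.indicator f) := by
    have hin : ContinuousOn (W.indicator f) W := hf.congr fun z hz => Set.indicator_of_mem hz f
    have hout : ContinuousOn (W.indicator f) Wᶜ :=
      continuousOn_const.congr fun z hz => Set.indicator_of_notMem hz f
    exact stronglyMeasurable_of_restrict_of_restrict_compl hW.measurableSet
      hin.domRestrict.stronglyMeasurable hout.domRestrict.stronglyMeasurable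
  set s : ℕ → ℝ := fun m => 1 / ((m : ℝ) + 1)
  have hs : Tendsto s atTop (𝓝[≠] 0) :=
    tendsto_nhdsWithin_of_tendsto_nhds_of_eventually_within _
      tendsto_one_div_add_atTop_nhds_zero_nat
      (Eventually.of_forall fun m => (Nat.one_div_pos_of_nat (α := ℝ)).ne')
  refine aestronglyMeasurable_of_tendsto_ae (u := atTop)
    (f := fun m z => (s m)⁻¹ • (W.indicator f (z + s m • e) - W.indicator f z))
    (fun m => ?_) ?_
  · exact (((hfm.comp_measurable (measurable_add_const _)).sub hfm).const_smul
      (s m)⁻¹).aestronglyMeasurable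
  · refine (ae_restrict_iff' hW.measurableSet).2 (ae_of_all _ fun z hz => ?_)
    refine ((hd z hz).hasLineDerivAt.tendsto_slope_zero.comp hs).congr' ?_
    have hlim : Tendsto (fun m => z + s m • e) atTop (𝓝 z) := by
      simpa using ((hs.mono_right nhdsWithin_le_nhds).smul_const e).const_add z
    filter_upwards [hlim (hW.mem_nhds hz)] with m hm
    have hm' : z + s m • e ∈ W := hm
    simp only [Function.comp_apply, Set.indicator_of_mem hz, Set.indicator_of_mem hm']

/-! ### Eilenberg's inequality -/

section Eilenberg

theorem eventually_injOn_code {Z : Type*} {h : Z → ℕ → Bool} (hh : Function.Injective h)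
    (s : Finset Z) :
    ∀ᶠ k in atTop, Set.InjOn (fun z (i : Fin k) => h z i) s := by
  have hpairs : ∀ᶠ k in atTop, ∀ z ∈ s, ∀ w ∈ s,
      (fun i : Fin k => h z i) = (fun i : Fin k => h w i) → z = w := by
    refine (Filter.eventually_all_finset s).2 fun z _ => (Filter.eventually_all_finset s).2
      fun w _ => ?_
    by_cases hzw : z = w
    · exact Eventually.of_forall fun _ _ => hzw
    · obtain ⟨m, hm⟩ := Function.ne_iff.1 (hh.ne hzw)
      filter_upwards [eventually_gt_atTop m] with k hk hcode
      exact absurd (congrFun hcode ⟨m, hk⟩) hm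
  exact hpairs.mono fun k hk z hz w hw => hk z hz w hw

variable {Z Y : Type*} [EMetricSpace Y] [MeasurableSpace Y] [BorelSpace Y]
  {p : Z → Y} {d : ℝ} {E : Set Z}

/-- A measurable majorant, up to the choice of measurable hulls, of the number of pieces of the
partition of `Z` into the fibres of `c` that the fibre of `p : E → Y` over `y` meets. -/
def fibreCount (d : ℝ) (p : Z → Y) (E : Set Z) {ι : Type*} [Fintype ι] (c : Z → ι) (y : Y) :
    ENNReal :=
  ∑ i, (toMeasurable μH[d] (p '' (E ∩ c ⁻¹' {i}))).indicator 1 y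

variable {ι : Type*} [Fintype ι] {c : Z → ι}

theorem measurable_fibreCount : Measurable (fibreCount d p E c) :=
  Finset.measurable_fun_sum _ fun _ _ => measurable_one.indicator (measurableSet_toMeasurable _ _)

theorem card_le_fibreCount {y : Y} {s : Finset Z} (hs : ↑s ⊆ E ∩ p ⁻¹' {y})
    (hinj : Set.InjOn c s) : (s.card : ENNReal) ≤ fibreCount d p E c y := by
  classical
  calc (s.card : ENNReal) = ∑ _i ∈ s.image c, 1 := by
        rw [Finset.sum_const, Finset.card_image_of_injOn hinj, nsmul_one]
    _ ≤ ∑ i ∈ s.image c, (toMeasurable μH[d] (p '' (E ∩ c ⁻¹' {i}))).indicator 1 y := by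
        refine Finset.sum_le_sum fun i hi => ?_
        obtain ⟨z, hz, rfl⟩ := Finset.mem_image.1 hi
        have hy : y ∈ p '' (E ∩ c ⁻¹' {c z}) := ⟨z, ⟨(hs hz).1, rfl⟩, (hs hz).2⟩
        rw [Set.indicator_of_mem (subset_toMeasurable _ _ hy), Pi.one_apply]
    _ ≤ fibreCount d p E c y := Finset.sum_le_sum_of_subset (Finset.subset_univ _)

variable [EMetricSpace Z] [MeasurableSpace Z] [BorelSpace Z] {K : NNReal}

theorem lintegral_fibreCount_le [MeasurableSpace ι] [MeasurableSingletonClass ι]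
    (hp : LipschitzWith K p) (hd : 0 ≤ d) (hc : Measurable c) :
    ∫⁻ y, fibreCount d p E c y ∂μH[d] ≤ (K : ENNReal) ^ d * μH[d] E := by
  have hfib : ∀ i, MeasurableSet (c ⁻¹' {i}) := fun i => hc (measurableSet_singleton i)
  unfold fibreCount
  rw [lintegral_finsetSum _ fun i _ => measurable_one.indicator (measurableSet_toMeasurable _ _)]
  calc ∑ i, ∫⁻ y, (toMeasurable μH[d] (p '' (E ∩ c ⁻¹' {i}))).indicator 1 y ∂μH[d]
      = ∑ i, μH[d] (p '' (E ∩ c ⁻¹' {i})) := Finset.sum_congr rfl fun i _ => by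
        rw [lintegral_indicator_one (measurableSet_toMeasurable _ _), measure_toMeasurable]
    _ ≤ ∑ i, (K : ENNReal) ^ d * μH[d].restrict E (c ⁻¹' {i}) := Finset.sum_le_sum fun i _ => by
        rw [Measure.restrict_apply (hfib i), Set.inter_comm]
        exact hp.hausdorffMeasure_image_le hd _
    _ = (K : ENNReal) ^ d * μH[d] E := by
        rw [← Finset.mul_sum, sum_measure_preimage_singleton _ fun i _ => hfib i,
          Finset.coe_univ, Set.preimage_univ, Measure.restrict_apply_univ]

theorem ae_finite_inter_fibre [MeasurableSpace.CountablySeparated Z] (hp : LipschitzWith K p)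
    (hd : 0 ≤ d) (hE : μH[d] E < ⊤) : ∀ᵐ y ∂μH[d], (E ∩ p ⁻¹' {y}).Finite := by
  obtain ⟨h, hhm, hh⟩ := MeasurableSpace.measurable_injection_nat_bool_of_countablySeparated Z
  set N : ℕ → Y → ENNReal := fun k => fibreCount d p E fun z (i : Fin k) => h z i
  have hNm : ∀ k, Measurable (N k) := fun k => measurable_fibreCount
  have hfatou : ∫⁻ y, liminf (fun k => N k y) atTop ∂μH[d] < ⊤ := by
    have hbound : ∀ k, ∫⁻ y, N k y ∂μH[d] ≤ (K : ENNReal) ^ d * μH[d] E := fun k =>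
      lintegral_fibreCount_le hp hd (measurable_pi_iff.2 fun i => (measurable_pi_iff.1 hhm) i)
    calc ∫⁻ y, liminf (fun k => N k y) atTop ∂μH[d]
        ≤ liminf (fun k => ∫⁻ y, N k y ∂μH[d]) atTop := lintegral_liminf_le hNm
      _ ≤ liminf (fun _ : ℕ => (K : ENNReal) ^ d * μH[d] E) atTop :=
        liminf_le_liminf (Eventually.of_forall hbound)
      _ = (K : ENNReal) ^ d * μH[d] E := liminf_const _
      _ < ⊤ := ENNReal.mul_lt_top (ENNReal.rpow_lt_top_of_nonneg hd ENNReal.coe_ne_top) hE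
  filter_upwards [ae_lt_top (Measurable.liminf hNm) hfatou.ne] with y hy
  by_contra hinf
  refine hy.ne (ENNReal.eq_top_of_forall_nnreal_le fun r => ?_)
  obtain ⟨m, hm⟩ := exists_nat_ge r
  obtain ⟨s, hs, rfl⟩ := Set.Infinite.exists_subset_card_eq hinf m
  refine le_liminf_of_le (by isBoundedDefault) ?_
  filter_upwards [eventually_injOn_code hh s] with k hk
  exact (ENNReal.coe_le_coe.2 hm).trans (by simpa using card_le_fibreCount hs hk)

end Eilenberg

/-! ### Weak Cauchy-Riemann equations -/

theorem complex_smul_eq_re_smul_add {M : Type*} [AddCommGroup M] [Module ℂ M] [Module ℝ M]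
    [IsScalarTower ℝ ℂ M] (w : M) (c : ℂ) : c • w = c.re • w + c.im • Complex.I • w := by
  rw [← algebraMap_smul ℂ c.re w, ← algebraMap_smul ℂ c.im, smul_smul, ← add_smul,
    Complex.coe_algebraMap, Complex.re_add_im]

section ComplexLinear

variable {V F : Type*} [AddCommGroup V] [Module ℂ V] [Module ℝ V] [IsScalarTower ℝ ℂ V]
  [AddCommGroup F] [Module ℂ F] [Module ℝ F] [IsScalarTower ℝ ℂ F] (A : V →ₗ[ℝ] F)

theorem map_complex_smul_of_map_I_smul {v : V} (h : A (Complex.I • v) = Complex.I • A v)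
    (c : ℂ) : A (c • v) = c • A v := by
  rw [complex_smul_eq_re_smul_add v, complex_smul_eq_re_smul_add (A v), map_add, map_smul,
    map_smul, h]

theorem map_I_smul_of_basis {ι : Type*} (b : Module.Basis ι ℂ V)
    (h : ∀ k, A (Complex.I • b k) = Complex.I • A (b k)) (v : V) :
    A (Complex.I • v) = Complex.I • A v := by
  induction b.mem_span v using Submodule.span_induction with
  | mem _ hx => obtain ⟨k, rfl⟩ := hx; exact h k
  | zero => simp only [smul_zero, map_zero]
  | add x y _ _ hx hy => simp only [smul_add, map_add, hx, hy]
  | smul c x _ hx =>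
    rw [smul_smul, map_complex_smul_of_map_I_smul A hx, map_complex_smul_of_map_I_smul A hx,
      mul_smul]

end ComplexLinear

theorem differentiableAt_complex_of_map_I_smul {V F : Type*} [NormedAddCommGroup V]
    [NormedSpace ℂ V] [NormedSpace ℝ V] [IsScalarTower ℝ ℂ V] [NormedAddCommGroup F]
    [NormedSpace ℂ F] {g : V → F} {D : V →L[ℝ] F} {z : V} (hg : HasFDerivAt g D z)
    (h : ∀ v, D (Complex.I • v) = Complex.I • D v) : DifferentiableAt ℂ g z := by
  let D' : V →L[ℂ] F :=
    { toFun := D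
      map_add' := D.map_add
      map_smul' := fun c v => map_complex_smul_of_map_I_smul D.toLinearMap (h v) c
      cont := D.continuous }
  exact (hasFDerivAt_of_restrictScalars ℝ (f' := D') hg rfl).differentiableAt

section SmulIndicator

variable {V : Type*} [NormedAddCommGroup V] [NormedSpace ℝ V] {F : Type*} [NormedAddCommGroup F]
  [NormedSpace ℝ F] {U : Set V} {φ : V → ℝ}

theorem fderiv_smul_indicator (hsupp : tsupport φ ⊆ U) (f : V → F) (e z : V) :
    fderiv ℝ φ z e • U.indicator f z = fderiv ℝ φ z e • f z := by
  by_cases hz : z ∈ U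
  · rw [Set.indicator_of_mem hz]
  · have h : fderiv ℝ φ z = 0 := fderiv_of_notMem_tsupport ℝ fun h => hz (hsupp h)
    rw [h, zero_apply, zero_smul, zero_smul]

theorem integrable_fderiv_smul [MeasurableSpace V] [BorelSpace V] {μ : Measure V} {f : V → F}
    (hU : MeasurableSet U) (hf : IntegrableOn f U μ) (hφ : ContDiff ℝ 1 φ)
    (hcs : HasCompactSupport φ) (hsupp : tsupport φ ⊆ U) (e : V) :
    Integrable (fun z => fderiv ℝ φ z e • f z) μ := by
  simp only [← fderiv_smul_indicator hsupp f]
  exact integrable_comp_smul_of_hasCompactSupport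
    ((hφ.continuous_fderiv one_ne_zero).clm_apply continuous_const) (hcs.fderiv_apply ℝ e)
    continuous_id ((integrable_indicator_iff hU).2 hf)

end SmulIndicator

section WeaklyHolomorphic

variable {V : Type*} [NormedAddCommGroup V] [NormedSpace ℂ V] [NormedSpace ℝ V]
  [MeasurableSpace V] {F : Type*} [NormedAddCommGroup F] [NormedSpace ℂ F]
  {f : V → F} {U : Set V} {μ : Measure V}

/-- `f` solves the Cauchy-Riemann equations on `U` in the sense of distributions, in the
coordinate-free form `∂f/∂(ie) = i ∂f/∂e` for all directions `e`. -/
def WeaklyHolomorphicOn (f : V → F) (U : Set V) (μ : Measure V) : Prop :=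
  ∀ φ : V → ℝ, ContDiff ℝ 1 φ → HasCompactSupport φ → tsupport φ ⊆ U → ∀ e : V,
    ∫ z, fderiv ℝ φ z (Complex.I • e) • f z ∂μ = Complex.I • ∫ z, fderiv ℝ φ z e • f z ∂μ

theorem WeaklyHolomorphicOn.indicator (h : WeaklyHolomorphicOn f U μ) :
    WeaklyHolomorphicOn (U.indicator f) U μ := by
  intro φ hφ hcs hsupp e
  simp only [fderiv_smul_indicator hsupp]
  exact h φ hφ hcs hsupp e

theorem weaklyHolomorphicOn_of_basis [BorelSpace V] [IsScalarTower ℝ ℂ V] {ι : Type*}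
    (b : Module.Basis ι ℂ V) (hU : MeasurableSet U) (hf : IntegrableOn f U μ)
    (hd : ∀ᵐ z ∂μ.restrict U, DifferentiableAt ℂ f z)
    (h1 : ∀ k, HasWeakDirDerivOn (b k) f (dirDeriv (b k) f) U μ)
    (hI : ∀ k, HasWeakDirDerivOn (Complex.I • b k) f (dirDeriv (Complex.I • b k) f) U μ) :
    WeaklyHolomorphicOn f U μ := by
  intro φ hφ hcs hsupp
  have hint := integrable_fderiv_smul hU hf hφ hcs hsupp
  let A : V →ₗ[ℝ] F :=
    { toFun := fun e => ∫ z, fderiv ℝ φ z e • f z ∂μ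
      map_add' := fun e e' => by
        simp only [map_add, add_smul]
        exact integral_add (hint e) (hint e')
      map_smul' := fun c e => by
        simp only [map_smul, smul_eq_mul, mul_smul, integral_smul, RingHom.id_apply] }
  refine map_I_smul_of_basis A b fun k => ?_
  have hCR : ∀ᵐ z ∂μ, φ z • dirDeriv (Complex.I • b k) f z =
      Complex.I • φ z • dirDeriv (b k) f z := by
    filter_upwards [(ae_restrict_iff' hU).1 hd] with z hz
    by_cases hzU : z ∈ U
    · rw [dirDeriv_I_smul _ (hz hzU), smul_comm]
    · rw [image_eq_zero_of_notMem_tsupport fun h => hzU (hsupp h), zero_smul, zero_smul, smul_zero]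
  exact (hI k φ hφ hcs hsupp).trans (by
    rw [integral_congr_ae hCR, integral_smul, ← smul_neg, ← h1 k φ hφ hcs hsupp]; rfl)

end WeaklyHolomorphic

/-! ### Weyl's lemma -/

theorem circleAverage_integral_comm {X E : Type*} [MeasurableSpace X] {μ : Measure X} [SFinite μ]
    [NormedAddCommGroup E] [NormedSpace ℝ E] {k : ℂ → X → E} {c : ℂ} {R : ℝ}
    (hk : Integrable (Function.uncurry fun (θ : ℝ) x => k (circleMap c R θ) x)
      ((volume.restrict (Set.Ioc 0 (2 * Real.pi))).prod μ)) :
    Real.circleAverage (fun ζ => ∫ x, k ζ x ∂μ) c R =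
      ∫ x, Real.circleAverage (fun ζ => k ζ x) c R ∂μ := by
  simp only [Real.circleAverage_def, intervalIntegral.integral_of_le Real.two_pi_pos.le]
  rw [integral_smul, integral_integral_swap hk]

theorem circleAverage_comp_sub_smul {V F : Type*} [NormedAddCommGroup V] [NormedSpace ℂ V]
    [NormedAddCommGroup F] [NormedSpace ℂ F] [CompleteSpace F] {g : V → F} {z : V} {ε : ℝ}
    (hd : ∀ w ∈ Metric.ball z ε, DifferentiableAt ℂ g w) {w : V} (hw : ‖w‖ < ε) :
    Real.circleAverage (fun ζ : ℂ => g (z - ζ • w)) 0 1 = g z := by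
  have hdisc : DiffContOnCl ℂ (fun ζ : ℂ => g (z - ζ • w)) (Metric.ball 0 |1|) := by
    refine DifferentiableOn.diffContOnCl fun ζ hζ => ?_
    rw [abs_one, closure_ball _ one_ne_zero, mem_closedBall_zero_iff] at hζ
    refine ((hd _ ?_).comp ζ (by fun_prop :
      DifferentiableAt ℂ (fun ζ : ℂ => z - ζ • w) ζ)).differentiableWithinAt
    rw [mem_ball_iff_norm, sub_sub_cancel_left, norm_neg, norm_smul]
    exact (mul_le_of_le_one_left (norm_nonneg _) hζ).trans_lt hw
  simpa only [zero_smul, sub_zero] using hdisc.circleAverage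

section Weyl

open ContinuousLinearMap
open scoped Convolution

section Convolution

variable {V F : Type*} [NormedAddCommGroup V] [NormedSpace ℝ V] [FiniteDimensional ℝ V]
  [MeasurableSpace V] [BorelSpace V] {μ : Measure V} [μ.IsAddHaarMeasure]
  [NormedAddCommGroup F] [NormedSpace ℝ F] {f : V → F}

theorem fderiv_convolution_lsmul_apply {ρ : V → ℝ} (hρ : ContDiff ℝ 1 ρ)
    (hcs : HasCompactSupport ρ) (hf : LocallyIntegrable f μ) (z v : V) :
    fderiv ℝ (ρ ⋆[lsmul ℝ ℝ, μ] f) z v = -∫ w, fderiv ℝ (fun y => ρ (z - y)) w v • f w ∂μ := by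
  have hint : Integrable (fun w => (lsmul ℝ ℝ : ℝ →L[ℝ] F →L[ℝ] F).precompL V
      (fderiv ℝ ρ w) (f (z - w))) μ :=
    (hcs.fderiv ℝ).convolutionExists_left _ (hρ.continuous_fderiv one_ne_zero) hf z
  rw [(hcs.hasFDerivAt_convolution_left (lsmul ℝ ℝ) hρ hf z).fderiv, convolution_def,
    ContinuousLinearMap.integral_apply hint, ← integral_neg, ← integral_sub_left_eq_self _ μ z]
  refine integral_congr_ae (ae_of_all _ fun w => ?_)
  have hchain : HasFDerivAt (fun y => ρ (z - y)) (-(fderiv ℝ ρ (z - w))) w := by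
    refine ((hρ.differentiable one_ne_zero (z - w)).hasFDerivAt.comp w
      ((hasFDerivAt_id w).const_sub z)).congr_fderiv ?_
    rw [ContinuousLinearMap.comp_neg, ContinuousLinearMap.comp_id]
  simp [hchain.fderiv]

theorem convolution_lsmul_left_comm [CompleteSpace F] {ρ σ : V → ℝ} (hρ : Continuous ρ)
    (hρs : HasCompactSupport ρ) (hσ : Continuous σ) (hσs : HasCompactSupport σ)
    (hf : Integrable f μ) :
    ρ ⋆[lsmul ℝ ℝ, μ] (σ ⋆[lsmul ℝ ℝ, μ] f) =
      σ ⋆[lsmul ℝ ℝ, μ] (ρ ⋆[lsmul ℝ ℝ, μ] f) := by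
  have hassoc : ∀ {ρ σ : V → ℝ}, Continuous ρ → HasCompactSupport ρ → Continuous σ →
      HasCompactSupport σ → ρ ⋆[lsmul ℝ ℝ, μ] (σ ⋆[lsmul ℝ ℝ, μ] f) =
        (ρ ⋆[mul ℝ ℝ, μ] σ) ⋆[lsmul ℝ ℝ, μ] f := by
    intro ρ σ hρ hρs hσ hσs
    ext z
    refine (convolution_assoc (mul ℝ ℝ) (lsmul ℝ ℝ) (lsmul ℝ ℝ) (lsmul ℝ ℝ)
      (fun x y v => mul_smul x y v) hρ.aestronglyMeasurable hσ.aestronglyMeasurable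
      hf.aestronglyMeasurable ?_ ?_ ?_).symm
    · exact ae_of_all _ (hρs.convolutionExists_left _ hρ hσ.locallyIntegrable)
    · exact ae_of_all _ (hσs.norm.convolutionExists_left _ hσ.norm hf.norm.locallyIntegrable)
    · exact hρs.norm.convolutionExists_left _ hρ.norm
        (hσs.norm.continuous_convolution_left _ hσ.norm
          hf.norm.locallyIntegrable).locallyIntegrable z
  have hcomm : ρ ⋆[mul ℝ ℝ, μ] σ = σ ⋆[mul ℝ ℝ, μ] ρ := by
    rw [← convolution_flip, ContinuousLinearMap.flip_mul]
  rw [hassoc hρ hρs hσ hσs, hassoc hσ hσs hρ hρs, hcomm]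

end Convolution

variable {V : Type*} [NormedAddCommGroup V] [InnerProductSpace ℝ V] [NormedSpace ℂ V]
  [FiniteDimensional ℝ V] [MeasurableSpace V] [BorelSpace V] {ρ σ : V → ℝ} {ε δ : ℝ}

/-- A mollifier of radius `ε` which is invariant under multiplication by the complex numbers of
modulus one; this symmetry makes it reproduce holomorphic functions. -/
structure IsCircularMollifier (ρ : V → ℝ) (ε : ℝ) : Prop where
  contDiff : ContDiff ℝ 1 ρ
  nonneg : ∀ w, 0 ≤ ρ w
  support_subset : Function.support ρ ⊆ Metric.ball 0 ε
  integral_eq_one : ∫ w, ρ w = 1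
  smul_eq : ∀ c : ℂ, ‖c‖ = 1 → ∀ w, ρ (c • w) = ρ w

theorem IsCircularMollifier.integrable (hρ : IsCircularMollifier ρ ε) : Integrable ρ :=
  integrable_of_integral_eq_one hρ.integral_eq_one

theorem IsCircularMollifier.hasCompactSupport (hρ : IsCircularMollifier ρ ε) :
    HasCompactSupport ρ :=
  .of_support_subset_isCompact (isCompact_closedBall 0 ε)
    (hρ.support_subset.trans Metric.ball_subset_closedBall)

theorem exists_isCircularMollifier (hε : 0 < ε) : ∃ ρ : V → ℝ, IsCircularMollifier ρ ε := by
  set bump : V → ℝ := fun w => Real.smoothTransition (ε ^ 2 - ‖w‖ ^ 2) with hbump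
  have hsmooth : ContDiff ℝ 1 bump :=
    (Real.smoothTransition.contDiff (n := 1)).comp (contDiff_const.sub (contDiff_norm_sq ℝ))
  have hsupp : Function.support bump = Metric.ball 0 ε := by
    ext w
    rw [Function.mem_support, hbump, Ne, Real.smoothTransition.zero_iff_nonpos, mem_ball_zero_iff,
      not_le, sub_pos, sq_lt_sq₀ (norm_nonneg _) hε.le]
  have hcs : HasCompactSupport bump := .of_support_subset_isCompact (isCompact_closedBall 0 ε)
    (hsupp.trans_subset Metric.ball_subset_closedBall)
  have hpos : 0 < ∫ w, bump w := by
    rw [integral_pos_iff_support_of_nonneg (fun w => Real.smoothTransition.nonneg _)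
      (hsmooth.continuous.integrable_of_hasCompactSupport hcs), hsupp]
    exact Metric.measure_ball_pos _ _ hε
  exact ⟨fun w => (∫ z, bump z)⁻¹ * bump w,
    { contDiff := contDiff_const.mul hsmooth
      nonneg := fun w => mul_nonneg (inv_nonneg.2 hpos.le) (Real.smoothTransition.nonneg _)
      support_subset := (Function.support_mul_subset_right _ _).trans hsupp.subset
      integral_eq_one := by rw [integral_const_mul, inv_mul_cancel₀ hpos.ne']
      smul_eq := fun c hc w => by simp only [hbump, norm_smul, hc, one_mul] }⟩

variable {F : Type*} [NormedAddCommGroup F] [NormedSpace ℂ F] {f g : V → F} {z : V}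

theorem WeaklyHolomorphicOn.differentiableAt_convolution [IsScalarTower ℝ ℂ V] {U : Set V}
    (h : WeaklyHolomorphicOn f U volume)
    (hf : LocallyIntegrable f) (hρ : ContDiff ℝ 1 ρ) (hcs : HasCompactSupport ρ)
    (hsupp : Function.support ρ ⊆ Metric.ball 0 ε) (hz : Metric.closedBall z ε ⊆ U) :
    DifferentiableAt ℂ (ρ ⋆[lsmul ℝ ℝ, volume] f) z := by
  have hD : DifferentiableAt ℝ (ρ ⋆[lsmul ℝ ℝ, volume] f) z :=
    (hcs.hasFDerivAt_convolution_left (lsmul ℝ ℝ) hρ hf z).differentiableAt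
  have htest : tsupport (fun y => ρ (z - y)) ⊆ Metric.closedBall z ε :=
    closure_minimal (fun y hy => by
      have hy' := hsupp (show z - y ∈ Function.support ρ from hy)
      rw [mem_ball_zero_iff] at hy'
      rw [mem_closedBall_iff_norm, norm_sub_rev]
      exact hy'.le) Metric.isClosed_closedBall
  refine differentiableAt_complex_of_map_I_smul hD.hasFDerivAt fun v => ?_
  rw [fderiv_convolution_lsmul_apply hρ hcs hf, fderiv_convolution_lsmul_apply hρ hcs hf,
    h (fun y => ρ (z - y)) (hρ.comp (contDiff_const.sub contDiff_id)) _ (htest.trans hz),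
    smul_neg]
  exact .of_support_subset_isCompact (isCompact_closedBall z ε)
    ((subset_tsupport _).trans htest)

theorem IsCircularMollifier.integrable_smul_comp_sub_circleMap (hρ : IsCircularMollifier ρ ε)
    (hg : Continuous g) (z : V) :
    Integrable (Function.uncurry fun (θ : ℝ) w => ρ w • g (z - circleMap 0 1 θ • w))
      ((volume.restrict (Set.Ioc 0 (2 * Real.pi))).prod volume) := by
  obtain ⟨M, hM⟩ := (isCompact_closedBall z ε).exists_bound_of_continuousOn hg.continuousOn
  have hmaj : Integrable (fun p : ℝ × V => ρ p.2 * M)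
      ((volume.restrict (Set.Ioc 0 (2 * Real.pi))).prod volume) :=
    (hρ.integrable.mul_const M).comp_snd _
  refine hmaj.mono' ?_ (ae_of_all _ fun ⟨θ, w⟩ => ?_)
  · exact ((hρ.contDiff.continuous.comp continuous_snd).smul
      (hg.comp (continuous_const.sub (((continuous_circleMap 0 1).comp continuous_fst).smul
        continuous_snd)))).aestronglyMeasurable
  · rw [Function.uncurry_apply_pair, norm_smul, Real.norm_of_nonneg (hρ.nonneg w)]
    by_cases hw : ρ w = 0
    · simp only [hw, zero_mul, le_refl]
    · refine mul_le_mul_of_nonneg_left (hM _ ?_) (hρ.nonneg w)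
      rw [mem_closedBall_iff_norm, sub_sub_cancel_left, norm_neg, norm_smul, norm_circleMap_zero,
        abs_one, one_mul]
      exact (mem_ball_zero_iff.1 (hρ.support_subset hw)).le

variable [IsScalarTower ℝ ℂ V]

theorem integral_comp_unit_smul {c : ℂ} (hc : ‖c‖ = 1) (k : V → F) :
    ∫ w, k (c • w) = ∫ w, k w := by
  have hc0 : c ≠ 0 := norm_ne_zero_iff.1 (hc ▸ one_ne_zero)
  let e : V ≃ₗᵢ[ℝ] V :=
    { toLinearEquiv := (LinearEquiv.smulOfNeZero ℂ V c hc0).restrictScalars ℝ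
      norm_map' := fun w => (norm_smul c w).trans (by rw [hc, one_mul]) }
  exact e.measurePreserving.integral_comp e.toHomeomorph.measurableEmbedding k

theorem IsCircularMollifier.convolution_eq_self [CompleteSpace F] (hρ : IsCircularMollifier ρ ε)
    (hg : Continuous g) (hd : ∀ w ∈ Metric.ball z ε, DifferentiableAt ℂ g w) :
    (ρ ⋆[lsmul ℝ ℝ, volume] g) z = g z := by
  have hrot : ∀ ζ ∈ Metric.sphere (0 : ℂ) |1|,
      ∫ w, ρ w • g (z - ζ • w) = ∫ w, ρ w • g (z - w) := fun ζ hζ => by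
    have hζ1 : ‖ζ‖ = 1 := by simpa using hζ
    rw [← integral_comp_unit_smul hζ1 fun w => ρ w • g (z - w)]
    simp only [hρ.smul_eq ζ hζ1]
  have hmean : ∀ w, Real.circleAverage (fun ζ : ℂ => ρ w • g (z - ζ • w)) 0 1 = ρ w • g z :=
    fun w => by
      rw [Real.circleAverage_fun_smul]
      by_cases hw : ρ w = 0
      · rw [hw, zero_smul, zero_smul]
      · rw [circleAverage_comp_sub_smul hd (mem_ball_zero_iff.1 (hρ.support_subset hw))]
  calc (ρ ⋆[lsmul ℝ ℝ, volume] g) z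
    _ = ∫ w, ρ w • g (z - w) := rfl
    _ = Real.circleAverage (fun ζ : ℂ => ∫ w, ρ w • g (z - ζ • w)) 0 1 :=
        (Real.circleAverage_const_on_circle hrot).symm
    _ = ∫ w, ρ w • g z := by
        rw [circleAverage_integral_comm (hρ.integrable_smul_comp_sub_circleMap hg z)]
        simp only [hmean]
    _ = g z := by rw [integral_smul_const, hρ.integral_eq_one, one_smul]

theorem WeaklyHolomorphicOn.convolution_convolution_eq_self [CompleteSpace F] {U : Set V}
    (h : WeaklyHolomorphicOn f U volume) (hf : Integrable f) (hρ : IsCircularMollifier ρ ε)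
    (hσ : IsCircularMollifier σ δ) (hz : Metric.closedBall z (ε + δ) ⊆ U) :
    (σ ⋆[lsmul ℝ ℝ, volume] (ρ ⋆[lsmul ℝ ℝ, volume] f)) z =
      (ρ ⋆[lsmul ℝ ℝ, volume] f) z := by
  refine hσ.convolution_eq_self (hρ.hasCompactSupport.continuous_convolution_left _
    hρ.contDiff.continuous hf.locallyIntegrable) fun w hw => ?_
  refine h.differentiableAt_convolution hf.locallyIntegrable hρ.contDiff hρ.hasCompactSupport
    hρ.support_subset ((Metric.closedBall_subset_closedBall' ?_).trans hz)
  gcongr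
  exact (Metric.mem_ball.1 hw).le

theorem WeaklyHolomorphicOn.convolution_eq_convolution [CompleteSpace F] {U : Set V}
    (h : WeaklyHolomorphicOn f U volume) (hf : Integrable f) (hρ : IsCircularMollifier ρ ε)
    (hσ : IsCircularMollifier σ δ) (hz : Metric.closedBall z (ε + δ) ⊆ U) :
    (ρ ⋆[lsmul ℝ ℝ, volume] f) z = (σ ⋆[lsmul ℝ ℝ, volume] f) z := by
  rw [← h.convolution_convolution_eq_self hf hρ hσ hz,
    ← h.convolution_convolution_eq_self hf hσ hρ (add_comm ε δ ▸ hz),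
    convolution_lsmul_left_comm hσ.contDiff.continuous hσ.hasCompactSupport
      hρ.contDiff.continuous hρ.hasCompactSupport hf]

theorem WeaklyHolomorphicOn.exists_differentiableOn_ball [CompleteSpace F] {z₀ : V} {r : ℝ}
    (h : WeaklyHolomorphicOn f (Metric.ball z₀ r) volume)
    (hf : IntegrableOn f (Metric.ball z₀ r)) (hr : 0 < r) :
    ∃ G : V → F, DifferentiableOn ℂ G (Metric.ball z₀ (r / 2)) ∧
      ∀ z ∈ Metric.ball z₀ (r / 2), ContinuousAt f z → G z = f z := by
  set B := Metric.ball z₀ r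
  have hg : Integrable (B.indicator f) := hf.integrable_indicator Metric.isOpen_ball.measurableSet
  have hsub : ∀ z ∈ Metric.ball z₀ (r / 2), Metric.closedBall z (r / 2) ⊆ B := fun z hz =>
    Metric.closedBall_subset_ball' (by linarith [Metric.mem_ball.1 hz])
  obtain ⟨ρ, hρ⟩ := exists_isCircularMollifier (V := V) (ε := r / 4) (by positivity)
  refine ⟨ρ ⋆[lsmul ℝ ℝ, volume] B.indicator f, fun z hz => ?_, fun z hz hc => ?_⟩
  · exact (h.indicator.differentiableAt_convolution hg.locallyIntegrable hρ.contDiff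
      hρ.hasCompactSupport hρ.support_subset ((Metric.closedBall_subset_closedBall
        (by linarith)).trans (hsub z hz))).differentiableWithinAt
  have hzB : B ∈ 𝓝 z :=
    Metric.isOpen_ball.mem_nhds (hsub z hz (Metric.mem_closedBall_self (by positivity)))
  have hev : B.indicator f =ᶠ[𝓝 z] f := by
    filter_upwards [hzB] with w hw using Set.indicator_of_mem hw f
  rw [← hev.eq_of_nhds]
  refine eq_of_forall_dist_le fun η hη => ?_
  obtain ⟨δ', hδ', hball⟩ := Metric.continuousAt_iff.1 (hc.congr hev.symm) η hη
  obtain ⟨σ, hσ⟩ := exists_isCircularMollifier (V := V) (ε := min δ' (r / 4)) (by positivity)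
  rw [h.indicator.convolution_eq_convolution hg hρ hσ
    ((Metric.closedBall_subset_closedBall (by linarith [min_le_right δ' (r / 4)])).trans
      (hsub z hz))]
  exact dist_convolution_le hη.le hσ.support_subset hσ.nonneg hσ.integral_eq_one
    hg.aestronglyMeasurable fun x hx =>
      (hball ((Metric.mem_ball.1 hx).trans_le (min_le_left _ _))).le

end Weyl

/-! ### Coordinate lines of `ℂⁿ` -/

theorem exists_measurePreserving_smul_prod {Y V : Type*} [NormedAddCommGroup Y] [NormedSpace ℝ Y]
    [FiniteDimensional ℝ Y] [MeasurableSpace Y] [BorelSpace Y] [NormedAddCommGroup V]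
    [NormedSpace ℝ V] [MeasurableSpace V] [BorelSpace V] (Φ : (Y × ℝ) ≃L[ℝ] V) (ν : Measure Y)
    [ν.IsAddHaarMeasure] (μ : Measure V) [μ.IsAddHaarMeasure] :
    ∃ c : NNReal, MeasurePreserving Φ ((c • ν).prod volume) μ := by
  have : FiniteDimensional ℝ V := Φ.toLinearEquiv.finiteDimensional
  have : ((ν.prod volume).map Φ).IsAddHaarMeasure := Φ.isAddHaarMeasure_map _
  refine ⟨μ.addHaarScalarFactor ((ν.prod volume).map Φ), Φ.continuous.measurable, ?_⟩
  rw [Measure.prod_smul_left, Measure.map_smul]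
  exact (Measure.isAddLeftInvariant_eq_smul μ _).symm

theorem measure_eq_zero_of_hausdorffMeasure_lt_top {V : Type*} [NormedAddCommGroup V]
    [NormedSpace ℝ V] [FiniteDimensional ℝ V] [MeasurableSpace V] [BorelSpace V] {d : ℝ}
    (hd : d < Module.finrank ℝ V) {E : Set V} (hE : μH[d] E < ⊤) (μ : Measure V)
    [μ.IsAddHaarMeasure] : μ E = 0 :=
  Measure.absolutelyContinuous_isAddHaarMeasure μ μH[Module.finrank ℝ V]
    ((Measure.hausdorffMeasure_zero_or_top hd E).resolve_right hE.ne)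

section Coordinates

variable {n : ℕ}

/-- The unit vector of `ℂⁿ` in the direction of the `j`-th real coordinate. -/
def dir (j : RealIdx n) : CSpace n := ofReal (EuclideanSpace.single j 1)

theorem dir_zero (k : Fin n) : dir (k, 0) = EuclideanSpace.single k 1 := by
  ext i
  by_cases h : i = k
  · subst h; simp [dir, ofReal, Complex.ext_iff]
  · simp [dir, ofReal, Complex.ext_iff, h]

theorem dir_one (k : Fin n) : dir (k, 1) = Complex.I • dir (k, 0) := by
  ext i
  by_cases h : i = k
  · subst h; simp [dir, ofReal, Complex.ext_iff]
  · simp [dir, ofReal, Complex.ext_iff, h]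

theorem norm_sq_ofReal (x : EuclideanSpace ℝ (RealIdx n)) : ‖ofReal x‖ ^ 2 = ‖x‖ ^ 2 := by
  rw [EuclideanSpace.norm_sq_eq, EuclideanSpace.real_norm_sq_eq, Fintype.sum_prod_type]
  refine Finset.sum_congr rfl fun k _ => ?_
  rw [← Complex.normSq_eq_norm_sq, Fin.sum_univ_two, sq, sq]
  rfl

variable (j : RealIdx n)

theorem norm_sq_point (t : ℝ) (X : Others j) : ‖point j t X‖ ^ 2 = t ^ 2 + ‖X‖ ^ 2 := by
  rw [point, norm_sq_ofReal, EuclideanSpace.real_norm_sq_eq, EuclideanSpace.real_norm_sq_eq,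
    Fintype.sum_eq_add_sum_subtype_ne _ j]
  congr 1
  · simp
  · exact Finset.sum_congr rfl fun i _ => by simp [i.2]

theorem finrank_others_add_one : Module.finrank ℝ (Others j) + 1 = 2 * n := by
  have := j.1.pos
  simp only [finrank_euclideanSpace, ne_eq, Fintype.card_subtype_compl, Fintype.card_prod,
    Fintype.card_fin, Fintype.card_unique]
  omega

theorem finrank_cSpace (n : ℕ) : Module.finrank ℝ (CSpace n) = 2 * n := by
  rw [← Module.finrank_mul_finrank ℝ ℂ (CSpace n), Complex.finrank_real_complex,
    finrank_euclideanSpace_fin]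

theorem point_add (t s : ℝ) (X Y : Others j) :
    point j (t + s) (X + Y) = point j t X + point j s Y := by
  ext k
  apply Complex.ext <;>
    simp only [point, ofReal, PiLp.add_apply, Complex.add_re, Complex.add_im] <;>
    split_ifs <;> simp

theorem point_smul (c t : ℝ) (X : Others j) : point j (c * t) (c • X) = c • point j t X := by
  ext k
  apply Complex.ext <;> simp [point, ofReal]

/-- The splitting of `ℂⁿ` into the `j`-th real coordinate and the other ones, the former being
put last. -/
def pointEquiv : (Others j × ℝ) ≃L[ℝ] CSpace n :=
  (LinearEquiv.ofInjectiveOfFinrankEq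
    { toFun := fun p => point j p.2 p.1
      map_add' := fun p q => point_add j p.2 q.2 p.1 q.1
      map_smul' := fun c p => point_smul j c p.2 p.1 }
    (by
      refine (injective_iff_map_eq_zero _).2 fun p (hp : point j p.2 p.1 = 0) => ?_
      have h := norm_sq_point j p.2 p.1
      rw [hp, norm_zero, zero_pow two_ne_zero, eq_comm, add_eq_zero_iff_of_nonneg (sq_nonneg _)
        (sq_nonneg _), sq_eq_zero_iff, sq_eq_zero_iff, norm_eq_zero] at h
      exact Prod.ext h.2 h.1)
    (by rw [Module.finrank_prod, Module.finrank_self, finrank_others_add_one,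
      finrank_cSpace])).toContinuousLinearEquiv

theorem pointEquiv_apply (X : Others j) (t : ℝ) : pointEquiv j (X, t) = point j t X := rfl

theorem pointEquiv_zero_one : pointEquiv j (0, 1) = dir j := by
  refine congrArg ofReal ?_
  ext i
  by_cases h : i = j <;> simp [h]

theorem lipschitzWith_fst_pointEquiv_symm :
    LipschitzWith 1 fun z => ((pointEquiv j).symm z).1 := by
  refine LipschitzWith.of_dist_le_mul fun z w => ?_
  rw [dist_eq_norm, dist_eq_norm, NNReal.coe_one, one_mul, ← Prod.fst_sub, ← map_sub]
  obtain ⟨⟨X, t⟩, h⟩ := (pointEquiv j).surjective (z - w)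
  rw [← h, ContinuousLinearEquiv.symm_apply_apply, pointEquiv_apply]
  refine le_of_sq_le_sq ?_ (norm_nonneg _)
  rw [norm_sq_point]
  exact le_add_of_nonneg_left (sq_nonneg t)

theorem finrank_others : (Module.finrank ℝ (Others j) : ℝ) = 2 * n - 1 :=
  eq_sub_of_add_eq (by exact_mod_cast finrank_others_add_one j)

theorem isAddHaarMeasure_hausdorffMeasure_others :
    (μH[2 * (n : ℝ) - 1] : Measure (Others j)).IsAddHaarMeasure := by
  rw [← finrank_others j]
  exact isAddHaarMeasure_hausdorffMeasure

theorem ae_finite_slice {E : Set (CSpace n)} (hE : μH[2 * (n : ℝ) - 1] E < ⊤) :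
    ∀ᵐ X : Others j ∂μH[2 * (n : ℝ) - 1], (slice j E X).Finite := by
  have hd : 0 ≤ 2 * (n : ℝ) - 1 := finrank_others j ▸ Nat.cast_nonneg _
  filter_upwards [ae_finite_inter_fibre (lipschitzWith_fst_pointEquiv_symm j) hd hE] with X hX
  refine (hX.preimage (f := fun t => pointEquiv j (X, t)) fun t _ s _ hts =>
    (Prod.ext_iff.1 ((pointEquiv j).injective hts)).2).subset fun t ht => ⟨ht, ?_⟩
  rw [Set.mem_preimage, ContinuousLinearEquiv.symm_apply_apply, Set.mem_singleton_iff]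

end Coordinates

theorem lineDifferentiableAt_dirDeriv {V F : Type*} [NormedAddCommGroup V] [NormedSpace ℂ V]
    [NormedSpace ℝ V] [IsScalarTower ℝ ℂ V] [NormedAddCommGroup F] [NormedSpace ℂ F]
    [CompleteSpace F] {f : V → F} {W : Set V} (hW : IsOpen W) (hf : DifferentiableOn ℂ f W)
    (e : V) {z : V} (hz : z ∈ W) : LineDifferentiableAt ℝ (dirDeriv e f) z e := by
  have hC2 : ContDiffAt ℝ (1 + 1) (fun t : ℝ => f (z + t • e)) 0 :=
    contDiffAt_comp_add_smul hW hf e (by rwa [zero_smul, add_zero])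
  have hd := (contDiffAt_deriv hC2).differentiableAt one_ne_zero
  rwa [funext (deriv_comp_add_smul e f z)] at hd

theorem dirDeriv_clm_comp {V F G : Type*} [NormedAddCommGroup V] [NormedSpace ℝ V]
    [NormedAddCommGroup F] [NormedSpace ℝ F] [NormedAddCommGroup G] [NormedSpace ℝ G]
    (T : F →L[ℝ] G) {f : V → F} {e z : V} (hf : LineDifferentiableAt ℝ f z e) :
    dirDeriv e (fun w => T (f w)) z = T (dirDeriv e f z) :=
  HasLineDerivAt.lineDeriv (T.hasFDerivAt.comp_hasDerivAt 0 hf.hasLineDerivAt)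

theorem dirDeriv_dirDeriv_clm_comp {V F G : Type*} [NormedAddCommGroup V] [NormedSpace ℂ V]
    [NormedSpace ℝ V] [IsScalarTower ℝ ℂ V] [NormedAddCommGroup F] [NormedSpace ℂ F]
    [CompleteSpace F] [NormedAddCommGroup G] [NormedSpace ℝ G] (T : F →L[ℝ] G) {f : V → F}
    {W : Set V} (hW : IsOpen W) (hf : DifferentiableOn ℂ f W) (e : V) {z : V} (hz : z ∈ W) :
    dirDeriv e (dirDeriv e fun w => T (f w)) z = T (dirDeriv e (dirDeriv e f) z) := by
  have hev : (dirDeriv e fun w => T (f w)) =ᶠ[𝓝 z] fun w => T (dirDeriv e f w) := by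
    filter_upwards [hW.mem_nhds hz] with w hw
    exact dirDeriv_clm_comp T (hasLineDerivAt_of_complex_differentiableAt e
      (hf.differentiableAt (hW.mem_nhds hw))).lineDifferentiableAt
  rw [dirDeriv, hev.lineDeriv_eq]
  exact dirDeriv_clm_comp T (lineDifferentiableAt_dirDeriv hW hf e hz)

section LocallyIntegrable

variable {n : ℕ} {Ω E : Set (CSpace n)}

theorem L1loc.locallyIntegrableOn {F : Type*} [NormedAddCommGroup F] {g : CSpace n → F}
    (hg : L1loc g Ω E) (hΩ : MeasurableSet Ω) (hE : volume E = 0) :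
    LocallyIntegrableOn g Ω volume := by
  rw [L1loc, Measure.restrict_congr_set (sdiff_null_ae_eq_self hE)] at hg
  intro z hz
  obtain ⟨s, hs, hgs⟩ := hg z hz
  rw [IntegrableOn, Measure.restrict_restrict' hΩ] at hgs
  exact ⟨s ∩ Ω, inter_mem hs self_mem_nhdsWithin, hgs⟩

theorem L1loc.of_re_of_im {g : CSpace n → ℂ} (hre : L1loc (fun z => (g z).re) Ω E)
    (him : L1loc (fun z => (g z).im) Ω E) : L1loc g Ω E := by
  intro z hz
  obtain ⟨s, hs, hre⟩ := hre z hz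
  obtain ⟨t, ht, him⟩ := him z hz
  exact ⟨s ∩ t, inter_mem hs ht, Integrable.re_im_iff.1
    ⟨hre.mono_set Set.inter_subset_left, him.mono_set Set.inter_subset_right⟩⟩

theorem L1loc.congr {F : Type*} [NormedAddCommGroup F] {g h : CSpace n → F} (hg : L1loc g Ω E)
    (hΩE : MeasurableSet (Ω \ E)) (hgh : Set.EqOn g h (Ω \ E)) : L1loc h Ω E :=
  LocallyIntegrableOn.congr (ae_restrict_of_ae (ae_restrict_of_forall_mem hΩE hgh)) hg

theorem l1loc_dirDeriv_dirDeriv {f : CSpace n → ℂ} {j : RealIdx n} (hΩE : IsOpen (Ω \ E))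
    (hf : DifferentiableOn ℂ f (Ω \ E))
    (hu : L1loc (partialDeriv j (partialDeriv j fun z => (f z).re)) Ω E)
    (hv : L1loc (partialDeriv j (partialDeriv j fun z => (f z).im)) Ω E) :
    L1loc (dirDeriv (dir j) (dirDeriv (dir j) f)) Ω E :=
  .of_re_of_im
    (hu.congr hΩE.measurableSet fun _ => dirDeriv_dirDeriv_clm_comp Complex.reCLM hΩE hf (dir j))
    (hv.congr hΩE.measurableSet fun _ => dirDeriv_dirDeriv_clm_comp Complex.imCLM hΩE hf (dir j))

end LocallyIntegrable

theorem eq_of_tendsto_of_liminf_eq_limsup {x y : ℕ → ℝ} {p q : ℝ} (hx : Tendsto x atTop (𝓝 p))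
    (hy : Tendsto y atTop (𝓝 q)) (h : liminf (fun l => (x l : EReal)) atTop =
      limsup (fun l => (y l : EReal)) atTop) : p = q := by
  have hx' := ((continuous_coe_real_ereal.tendsto p).comp hx).liminf_eq
  have hy' := ((continuous_coe_real_ereal.tendsto q).comp hy).limsup_eq
  exact EReal.coe_injective (hx'.symm.trans (h.trans hy'))

theorem tendsto_nhdsLT_of_monotone {a : ℕ → ℝ} {x : ℝ} (ha : Monotone a)
    (hx : Tendsto a atTop (𝓝 x)) (hne : ∀ l, a l ≠ x) : Tendsto a atTop (𝓝[<] x) :=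
  tendsto_nhdsWithin_of_tendsto_nhds_of_eventually_within _ hx
    (Eventually.of_forall fun l => (ha.ge_of_tendsto hx l).lt_of_ne (hne l))

theorem tendsto_nhdsGT_of_antitone {b : ℕ → ℝ} {x : ℝ} (hb : Antitone b)
    (hx : Tendsto b atTop (𝓝 x)) (hne : ∀ l, b l ≠ x) : Tendsto b atTop (𝓝[>] x) :=
  tendsto_nhdsWithin_of_tendsto_nhds_of_eventually_within _ hx
    (Eventually.of_forall fun l => (hb.le_of_tendsto hx l).lt_of_ne' (hne l))

section Matching

variable {n : ℕ} {j : RealIdx n} {Ω E : Set (CSpace n)} {f : CSpace n → ℂ} {X : Others j}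

theorem MatchingSlopes.eq_of_tendsto {g : CSpace n → ℝ} {a b : ℕ → ℝ} {p q : ℝ}
    (h : MatchingSlopes j g X a b)
    (hp : Tendsto (fun l => partialDeriv j g (point j (a l) X)) atTop (𝓝 p))
    (hq : Tendsto (fun l => partialDeriv j g (point j (b l) X)) atTop (𝓝 q)) : p = q := by
  obtain ⟨s, ha, hb⟩ := h
  exact eq_of_tendsto_of_liminf_eq_limsup hp hq (ha.trans hb.symm)

/-- The function `f` and its slopes in the `j`-th direction match across the point `x₀` of the
line through `X` in the sense of condition (iii): along sequences of `Ω \ E` increasing,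
respectively decreasing, to `x₀`. -/
def MatchesAcross (j : RealIdx n) (Ω E : Set (CSpace n)) (f : CSpace n → ℂ) (X : Others j)
    (x₀ : ℝ) : Prop :=
  ∃ a b : ℕ → ℝ, (∀ l, a l ∈ slice j (Ω \ E) X) ∧ (∀ l, b l ∈ slice j (Ω \ E) X) ∧
    Monotone a ∧ Tendsto a atTop (𝓝 x₀) ∧ Antitone b ∧ Tendsto b atTop (𝓝 x₀) ∧
    (∃ c : ℂ, Tendsto (fun l => f (point j (a l) X)) atTop (𝓝 c) ∧
      Tendsto (fun l => f (point j (b l) X)) atTop (𝓝 c)) ∧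
    MatchingSlopes j (fun z => (f z).re) X a b ∧ MatchingSlopes j (fun z => (f z).im) X a b

theorem MatchesAcross.noJumpAt {x₀ : ℝ} (h : MatchesAcross j Ω E f X x₀)
    (hx₀ : x₀ ∈ slice j E X) : NoJumpAt (fun t => f (point j t X)) x₀ := by
  obtain ⟨a, b, ha, hb, ham, hax, hbm, hbx, ⟨c, hca, hcb⟩, -, -⟩ := h
  intro l r hl hr
  have hl' := hl.comp (tendsto_nhdsLT_of_monotone ham hax fun k hk => (ha k).2 (hk ▸ hx₀))
  have hr' := hr.comp (tendsto_nhdsGT_of_antitone hbm hbx fun k hk => (hb k).2 (hk ▸ hx₀))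
  rw [tendsto_nhds_unique hl' hca, tendsto_nhds_unique hr' hcb]

theorem deriv_comp_point {F : Type*} [NormedAddCommGroup F] [NormedSpace ℝ F]
    (f : CSpace n → F) (t : ℝ) :
    deriv (fun t => f (point j t X)) t = dirDeriv (dir j) f (point j t X) := by
  rw [← pointEquiv_zero_one]
  exact congrFun (deriv_comp_prodMk (pointEquiv j) f X) t

theorem MatchesAcross.noJumpAt_deriv {x₀ : ℝ} (h : MatchesAcross j Ω E f X x₀)
    (hx₀ : x₀ ∈ slice j E X) (hΩE : IsOpen (Ω \ E)) (hf : DifferentiableOn ℂ f (Ω \ E)) :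
    NoJumpAt (deriv fun t => f (point j t X)) x₀ := by
  obtain ⟨a, b, ha, hb, ham, hax, hbm, hbx, -, hu, hv⟩ := h
  intro l r hl hr
  have hl' := hl.comp (tendsto_nhdsLT_of_monotone ham hax fun k hk => (ha k).2 (hk ▸ hx₀))
  have hr' := hr.comp (tendsto_nhdsGT_of_antitone hbm hbx fun k hk => (hb k).2 (hk ▸ hx₀))
  have hpart : ∀ (T : ℂ →L[ℝ] ℝ) (s : ℕ → ℝ) (p : ℂ), (∀ k, s k ∈ slice j (Ω \ E) X) →
      Tendsto ((deriv fun t => f (point j t X)) ∘ s) atTop (𝓝 p) →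
      Tendsto (fun k => partialDeriv j (fun z => T (f z)) (point j (s k) X)) atTop (𝓝 (T p)) :=
    fun T s p hs hp => ((T.continuous.tendsto p).comp hp).congr fun k => by
      have hd := hf.differentiableAt (hΩE.mem_nhds (hs k))
      exact (congrArg T (deriv_comp_point f (s k))).trans (dirDeriv_clm_comp T
        (hasLineDerivAt_of_complex_differentiableAt _ hd).lineDifferentiableAt).symm
  exact Complex.ext
    (hu.eq_of_tendsto (hpart Complex.reCLM a l ha hl') (hpart Complex.reCLM b r hb hr'))
    (hv.eq_of_tendsto (hpart Complex.imCLM a l ha hl') (hpart Complex.imCLM b r hb hr'))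

theorem contDiffAt_comp_point {F : Type*} [NormedAddCommGroup F] [NormedSpace ℂ F]
    [CompleteSpace F] {f : CSpace n → F} {W : Set (CSpace n)} (hW : IsOpen W)
    (hf : DifferentiableOn ℂ f W) {t : ℝ} (ht : t ∈ slice j W X) {m : WithTop ℕ∞} :
    ContDiffAt ℝ m (fun t => f (point j t X)) t := by
  have hline : ∀ t, point j t X = pointEquiv j (X, 0) + t • dir j := fun t => by
    rw [← pointEquiv_zero_one, ← apply_prodMk_eq_add_smul, pointEquiv_apply]
  simp only [hline]
  exact contDiffAt_comp_add_smul hW hf _ (hline t ▸ ht)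

theorem jumpFreeC1On_of_matchesAcross (hΩE : IsOpen (Ω \ E)) (hf : DifferentiableOn ℂ f (Ω \ E))
    (hfin : (slice j E X).Finite) (h : ∀ x₀ ∈ slice j E X, MatchesAcross j Ω E f X x₀) :
    JumpFreeC1On (fun t => f (point j t X)) (slice j Ω X) ∧
      JumpFreeC1On (deriv fun t => f (point j t X)) (slice j Ω X) :=
  ⟨jumpFreeC1On_of_contDiffAt hfin (fun _ ht => contDiffAt_comp_point hΩE hf ht)
      fun x₀ hx₀ => (h x₀ hx₀).noJumpAt hx₀,
    jumpFreeC1On_of_contDiffAt hfin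
      (fun _ ht => contDiffAt_deriv (contDiffAt_comp_point hΩE hf ht))
      fun x₀ hx₀ => (h x₀ hx₀).noJumpAt_deriv hx₀ hΩE hf⟩

end Matching

/-! ### Extension across a null set -/

theorem subset_closure_sdiff_of_measure_eq_zero {X : Type*} [TopologicalSpace X]
    [MeasurableSpace X] {μ : Measure X} [μ.IsOpenPosMeasure] {Ω E : Set X} (hΩ : IsOpen Ω)
    (hE : μ E = 0) : Ω ⊆ closure (Ω \ E) := by
  intro z hz
  refine mem_closure_iff.2 fun U hU hzU => ?_
  by_contra hne
  have hsub : U ∩ Ω ⊆ E := fun w hw => by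
    by_contra hwE
    exact hne ⟨w, hw.1, hw.2, hwE⟩
  exact ((hU.inter hΩ).measure_pos μ ⟨z, hzU, hz⟩).ne' (measure_mono_null hsub hE)

theorem eqOn_extendFrom {X Y : Type*} [TopologicalSpace X] [TopologicalSpace Y] [T2Space Y]
    {U W : Set X} {f G : X → Y} (hdense : U ⊆ closure W) (hU : IsOpen U) (hG : ContinuousOn G U)
    (hGf : Set.EqOn G f (U ∩ W)) : Set.EqOn (extendFrom W f) G U := by
  intro z hz
  refine extendFrom_eq (hdense hz) (((hG.continuousAt (hU.mem_nhds hz)).tendsto.mono_left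
    nhdsWithin_le_nhds).congr' ?_)
  filter_upwards [nhdsWithin_le_nhds (hU.mem_nhds hz), self_mem_nhdsWithin] with w hw hwW
  exact hGf ⟨hw, hwW⟩

theorem exists_extension_of_local {V F : Type*} [NormedAddCommGroup V] [NormedSpace ℂ V]
    [NormedAddCommGroup F] [NormedSpace ℂ F] {Ω W : Set V} {f : V → F} (hΩ : IsOpen Ω)
    (hdense : Ω ⊆ closure W) (hW : IsOpen W) (hf : ContinuousOn f W)
    (hlocal : ∀ z ∈ Ω, ∃ G : V → F, ∃ U ∈ 𝓝 z, DifferentiableOn ℂ G U ∧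
      Set.EqOn G f (U ∩ W)) :
    ∃ g : V → F, (DifferentiableOn ℂ g Ω ∧ Set.EqOn g f W) ∧
      ∀ h : V → F, DifferentiableOn ℂ h Ω → Set.EqOn h f W → Set.EqOn h g Ω := by
  refine ⟨extendFrom W f, ⟨fun z hz => ?_, ?_⟩, fun h hh hhf => ?_⟩
  · obtain ⟨G, U, hU, hG, hGf⟩ := hlocal z hz
    set U' := interior U ∩ Ω
    have hU' : IsOpen U' := isOpen_interior.inter hΩ
    have hzU' : U' ∈ 𝓝 z := hU'.mem_nhds ⟨mem_interior_iff_mem_nhds.2 hU, hz⟩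
    have hsub : U' ⊆ U := Set.inter_subset_left.trans interior_subset
    have heq := eqOn_extendFrom (Set.inter_subset_right.trans hdense) hU'
      (hG.continuousOn.mono hsub) (hGf.mono (Set.inter_subset_inter_left W hsub))
    exact ((hG.mono hsub).differentiableAt hzU').congr_of_eventuallyEq
      (heq.eventuallyEq_of_mem hzU') |>.differentiableWithinAt
  · exact eqOn_extendFrom subset_closure hW hf fun _ _ => rfl
  · exact (eqOn_extendFrom hdense hΩ hh.continuousOn (hhf.mono Set.inter_subset_right)).symm

theorem isOpen_sdiff_of_isClosed_preimage {X : Type*} [TopologicalSpace X] {Ω E : Set X}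
    (hΩ : IsOpen Ω) (hE : IsClosed ((↑) ⁻¹' E : Set Ω)) : IsOpen (Ω \ E) := by
  have h := hΩ.isOpenMap_subtype_val _ hE.isOpen_compl
  rwa [← Set.preimage_compl, Subtype.image_preimage_coe, ← Set.sdiff_eq] at h

section LocalExtension

variable {n : ℕ} {Ω E : Set (CSpace n)} {F : Type*} [NormedAddCommGroup F] [NormedSpace ℂ F]
  {f : CSpace n → F} {z : CSpace n}

theorem weaklyHolomorphicOn_of_hasWeakDirDerivOn_dir {U : Set (CSpace n)} (hU : MeasurableSet U)
    (hf : IntegrableOn f U) (hd : ∀ᵐ w ∂volume.restrict U, DifferentiableAt ℂ f w)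
    (h : ∀ j, HasWeakDirDerivOn (dir j) f (dirDeriv (dir j) f) U volume) :
    WeaklyHolomorphicOn f U volume := by
  have hb (k : Fin n) : (EuclideanSpace.basisFun (Fin n) ℂ).toBasis k = dir (k, 0) := by
    rw [OrthonormalBasis.coe_toBasis, EuclideanSpace.basisFun_apply, dir_zero]
  refine weaklyHolomorphicOn_of_basis (EuclideanSpace.basisFun (Fin n) ℂ).toBasis hU hf hd
    (fun k => ?_) fun k => ?_
  · rw [hb]
    exact h (k, 0)
  · rw [hb, ← dir_one]
    exact h (k, 1)

variable [CompleteSpace F]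

theorem eventually_hasWeakDirDerivOn_dir (j : RealIdx n) (hΩ : IsOpen Ω)
    (hΩE : IsOpen (Ω \ E)) (hE : volume E = 0) (hf : DifferentiableOn ℂ f (Ω \ E))
    (hf1 : L1loc f Ω E) (hf2 : L1loc (dirDeriv (dir j) (dirDeriv (dir j) f)) Ω E)
    (hlines : ∀ᵐ X : Others j ∂μH[2 * (n : ℝ) - 1],
      JumpFreeC1On (fun t => f (point j t X)) (slice j Ω X) ∧
        JumpFreeC1On (deriv fun t => f (point j t X)) (slice j Ω X)) (hz : z ∈ Ω) :
    ∀ᶠ U in (𝓝 z).smallSets, HasWeakDirDerivOn (dir j) f (dirDeriv (dir j) f) U volume := by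
  have := isAddHaarMeasure_hausdorffMeasure_others j
  obtain ⟨c, hc⟩ := exists_measurePreserving_smul_prod (pointEquiv j)
    (μH[2 * (n : ℝ) - 1] : Measure (Others j)) (volume : Measure (CSpace n))
  have hmeas : AEStronglyMeasurable (dirDeriv (dir j) f) (volume.restrict Ω) := by
    rw [← Measure.restrict_congr_set (sdiff_null_ae_eq_self hE)]
    exact aestronglyMeasurable_dirDeriv hΩE hf.continuousOn fun w hw =>
      (hasLineDerivAt_of_complex_differentiableAt _
        (hf.differentiableAt (hΩE.mem_nhds hw))).lineDifferentiableAt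
  rw [← pointEquiv_zero_one] at hf2 hmeas ⊢
  exact eventually_hasWeakDirDerivOn hc hΩ (hf1.locallyIntegrableOn hΩ.measurableSet hE) hmeas
    (hf2.locallyIntegrableOn hΩ.measurableSet hE) (Measure.ae_smul_measure hlines c) hz

theorem exists_local_extension (hΩ : IsOpen Ω) (hΩE : IsOpen (Ω \ E))
    (hE : volume E = 0) (hf : DifferentiableOn ℂ f (Ω \ E))
    (hf1 : L1loc f Ω E) (hweak : ∀ j, ∀ᶠ U in (𝓝 z).smallSets,
      HasWeakDirDerivOn (dir j) f (dirDeriv (dir j) f) U volume) (hz : z ∈ Ω) :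
    ∃ G : CSpace n → F, ∃ U ∈ 𝓝 z, DifferentiableOn ℂ G U ∧ Set.EqOn G f (U ∩ (Ω \ E)) := by
  have hint : ∀ᶠ U in (𝓝 z).smallSets, IntegrableOn f U := by
    rw [← hΩ.nhdsWithin_eq hz]
    exact (hf1.locallyIntegrableOn hΩ.measurableSet hE z hz).eventually
  obtain ⟨r, hr, hw, hi, hball⟩ :=
    ((eventually_all.2 hweak).and (hint.and (eventually_smallSets_subset.2
      (hΩ.mem_nhds hz)))).exists_mem_basis_of_smallSets Metric.nhds_basis_ball
  have hd : ∀ᵐ w ∂volume.restrict (Metric.ball z r), DifferentiableAt ℂ f w := by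
    filter_upwards [ae_restrict_mem measurableSet_ball,
      ae_restrict_of_ae (measure_eq_zero_iff_ae_notMem.1 hE)] with w hw hwE
    exact hf.differentiableAt (hΩE.mem_nhds ⟨hball hw, hwE⟩)
  obtain ⟨G, hG, hGf⟩ := (weaklyHolomorphicOn_of_hasWeakDirDerivOn_dir measurableSet_ball hi hd
    hw).exists_differentiableOn_ball hi hr
  exact ⟨G, Metric.ball z (r / 2), Metric.ball_mem_nhds z (half_pos hr), hG, fun w hw =>
    hGf w hw.1 (hf.continuousOn.continuousAt (hΩE.mem_nhds hw.2))⟩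

end LocalExtension

theorem ae_jumpFreeC1On_of_matchesAcross {n : ℕ} {Ω E : Set (CSpace n)} (j : RealIdx n)
    (hΩE : IsOpen (Ω \ E)) (hEH : μH[2 * (n : ℝ) - 1] E < ⊤) {f : CSpace n → ℂ}
    (hf : DifferentiableOn ℂ f (Ω \ E))
    (hlines : ∀ᵐ X : Others j ∂μH[2 * (n : ℝ) - 1],
      (slice j E X).Finite → ∀ x₀ ∈ slice j E X, MatchesAcross j Ω E f X x₀) :
    ∀ᵐ X : Others j ∂μH[2 * (n : ℝ) - 1],
      JumpFreeC1On (fun t => f (point j t X)) (slice j Ω X) ∧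
        JumpFreeC1On (deriv fun t => f (point j t X)) (slice j Ω X) := by
  filter_upwards [ae_finite_slice j hEH, hlines] with X hfin hX
  exact jumpFreeC1On_of_matchesAcross hΩE hf hfin (hX hfin)

theorem volume_eq_zero_of_hausdorffMeasure_lt_top {n : ℕ} {E : Set (CSpace n)}
    (hEH : μH[2 * (n : ℝ) - 1] E < ⊤) : volume E = 0 := by
  refine measure_eq_zero_of_hausdorffMeasure_lt_top ?_ hEH volume
  rw [finrank_cSpace]
  push_cast
  exact sub_one_lt _

end HolExt

end

theorem theorem4_general {n : ℕ} {Ω E : Set (HolExt.CSpace n)} {F : Type*}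
    [NormedAddCommGroup F] [NormedSpace ℂ F] [CompleteSpace F]
    (hΩ : IsOpen Ω) (hE : IsClosed ((↑) ⁻¹' E : Set Ω)) (hE0 : volume E = 0)
    {f : HolExt.CSpace n → F} (hf : DifferentiableOn ℂ f (Ω \ E)) (hf1 : HolExt.L1loc f Ω E)
    (hf2 : ∀ j : HolExt.RealIdx n,
      HolExt.L1loc (HolExt.dirDeriv (HolExt.dir j) (HolExt.dirDeriv (HolExt.dir j) f)) Ω E)
    (hlines : ∀ j : HolExt.RealIdx n, ∀ᵐ X : HolExt.Others j ∂μH[2 * (n : ℝ) - 1],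
      HolExt.JumpFreeC1On (fun t => f (HolExt.point j t X)) (HolExt.slice j Ω X) ∧
        HolExt.JumpFreeC1On (deriv fun t => f (HolExt.point j t X)) (HolExt.slice j Ω X)) :
    ∃ g : HolExt.CSpace n → F,
      (DifferentiableOn ℂ g Ω ∧ Set.EqOn g f (Ω \ E)) ∧
      ∀ h : HolExt.CSpace n → F,
        DifferentiableOn ℂ h Ω → Set.EqOn h f (Ω \ E) → Set.EqOn h g Ω := by
  have hΩE : IsOpen (Ω \ E) := HolExt.isOpen_sdiff_of_isClosed_preimage hΩ hE
  refine HolExt.exists_extension_of_local hΩ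
    (HolExt.subset_closure_sdiff_of_measure_eq_zero hΩ hE0) hΩE hf.continuousOn fun z hz => ?_
  refine HolExt.exists_local_extension hΩ hΩE hE0 hf hf1 (fun j => ?_) hz
  exact HolExt.eventually_hasWeakDirDerivOn_dir j hΩ hΩE hE0 hf hf1 (hf2 j) (hlines j) hz

theorem theorem4 (n : ℕ) (hn : 1 ≤ n) (Ω E : Set (HolExt.CSpace n))
    (hΩ : IsOpen Ω) (hΩc : IsConnected Ω)
    (hEΩ : E ⊆ Ω) (hE : IsClosed ((↑) ⁻¹' E : Set Ω))
    (hEH : μH[2 * (n : ℝ) - 1] E < ⊤)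
    (f : HolExt.CSpace n → ℂ) (hf : DifferentiableOn ℂ f (Ω \ E))
    (u v : HolExt.CSpace n → ℝ) (hu : u = fun z => (f z).re) (hv : v = fun z => (f z).im)
    (hf1 : HolExt.L1loc f Ω E)
    (hu2 : ∀ j : HolExt.RealIdx n,
      HolExt.L1loc (HolExt.partialDeriv j (HolExt.partialDeriv j u)) Ω E)
    (hv2 : ∀ j : HolExt.RealIdx n,
      HolExt.L1loc (HolExt.partialDeriv j (HolExt.partialDeriv j v)) Ω E)
    (hlines : ∀ j : HolExt.RealIdx n, ∀ᵐ X : HolExt.Others j ∂μH[2 * (n : ℝ) - 1],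
      (HolExt.slice j E X).Finite →
      ∀ x₀ ∈ HolExt.slice j E X, ∃ a b : ℕ → ℝ,
        (∀ l, a l ∈ HolExt.slice j (Ω \ E) X) ∧ (∀ l, b l ∈ HolExt.slice j (Ω \ E) X) ∧
        Monotone a ∧ Tendsto a atTop (𝓝 x₀) ∧ Antitone b ∧ Tendsto b atTop (𝓝 x₀) ∧
        (∃ c : ℂ, Tendsto (fun l => f (HolExt.point j (a l) X)) atTop (𝓝 c) ∧
          Tendsto (fun l => f (HolExt.point j (b l) X)) atTop (𝓝 c)) ∧
        HolExt.MatchingSlopes j u X a b ∧ HolExt.MatchingSlopes j v X a b) :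
    ∃ g : HolExt.CSpace n → ℂ,
      (DifferentiableOn ℂ g Ω ∧ Set.EqOn g f (Ω \ E)) ∧
      ∀ h : HolExt.CSpace n → ℂ,
        DifferentiableOn ℂ h Ω → Set.EqOn h f (Ω \ E) → Set.EqOn h g Ω := by
  have hΩE : IsOpen (Ω \ E) := HolExt.isOpen_sdiff_of_isClosed_preimage hΩ hE
  subst hu hv
  exact theorem4_general hΩ hE (HolExt.volume_eq_zero_of_hausdorffMeasure_lt_top hEH) hf hf1
    (fun j => HolExt.l1loc_dirDeriv_dirDeriv hΩE hf (hu2 j) (hv2 j))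
    fun j => HolExt.ae_jumpFreeC1On_of_matchesAcross j hΩE hEH hf (hlines j)
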